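/- **Setting.** Let $k_i,c_i>0$ ($i=1,2,3$), $\rho,\ell_1,\ell_2>0$, $B>C>D$, $\alpha_i=k_i/(\rho c_i)$, $\delta_i=\rho\ell_i$, and assume $\alpha_2>\alpha_3$. Consider temperatures $\Phi_3$ on $0\le x\le y_2(t)$, $\Phi_2$ on $y_2(t)\le x\le y_1(t)$, $\Phi_1$ on $x\ge y_1(t)$ ($t>0$) and continuous free boundaries $0<y_2<y_1$ with $y_1(0)=y_2(0)=0$, such that $\partial_t\Phi_i=\alpha_i\,\partial_x^2\Phi_i$ in the interior of each phase, and, for all $t>0$, $$\Phi_3(y_2(t),t)=\Phi_2(y_2(t),t)=B,\quad \Phi_2(y_1(t),t)=\Phi_1(y_1(t),t)=C,\quad \Phi_1(x,0)=\Phi_1(+\infty,t)=D\ (x>0),$$ $$k_2\,\partial_x\Phi_2(y_2(t),t)-k_3\,\partial_x\Phi_3(y_2(t),t)=\delta_2\,\dot y_2(t),\qquad k_1\,\partial_x\Phi_1(y_1(t),t)-k_2\,\partial_x\Phi_2(y_1(t),t)=\delta_1\,\dot y_1(t).$$ Problem (P1) adds the Robin condition $k_3\,\partial_x\Phi_3(0,t)=\frac{h_0}{\sqrt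 t}\,(\Phi_3(0,t)-A_\infty)$, and problem (P3) adds the Neumann condition $k_3\,\partial_x\Phi_3(0,t)=-\frac{q_0}{\sqrt t}$, for $t>0$. "Solution" means a classical solution of similarity type: $\Phi_i=a_i+b_i\,\mathrm{erf}\big(x/(2\sqrt{\alpha_i t})\big)$ in phase $i$ and $y_i(t)=2\xi_i\sqrt{\alpha_1 t}$, with constants $a_i,b_i$ and $\xi_1,\xi_2>0$. "The solution" means that such a solution exists and is unique. Put $$\mathrm{Ste}_1=\tfrac{c_1(C-D)}{\ell_1},\quad \mathrm{Ste}_2=\tfrac{c_2(B-C)}{\ell_2},\quad \varphi(z)=z+\tfrac{\mathrm{Ste}_1}{\sqrt\pi}\tfrac{e^{-z^2}}{\mathrm{erfc}(z)},$$ $$H(z)=\mathrm{erf}\Big(z\sqrt{\tfrac{\alpha_1}{\alpha_2}}\Big)-\tfrac{\mathrm{Ste}_2}{\sqrt\pi}\tfrac{\ell_2}{\ell_1}\sqrt{\tfrac{k_2c_1}{k_1c_2}}\;\tfrac{e^{-z^2\alpha_1/\alpha_2}}{\varphi(z)},\qquad Q(z)=\tfrac{\ell_1}{\ell_2}\varphi(z)\,e^{z^2\alpha_1/\alpha_2},\qquad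 \sigma(z)=\sqrt{\tfrac{\alpha_2}{\alpha_1}}\,\mathrm{erf}^{-1}(H(z)),$$ $$T(z)=\tfrac{\mathrm{Ste}_2}{\sqrt\pi\,c_2}\,\tfrac{A_\infty-B}{B-C}\sqrt{\tfrac{k_3c_1c_3}{k_1}}\;\tfrac{\exp\left(-z^2\alpha_1(1/\alpha_3-1/\alpha_2)\right)}{\frac{k_3}{h_0\sqrt{\pi\alpha_3}}+\mathrm{erf}\left(z\sqrt{\alpha_1/\alpha_3}\right)}-z\,e^{z^2\alpha_1/\alpha_2},$$ $$P(z)=e^{z^2\alpha_1/\alpha_2}\Big[-z+\tfrac{q_0}{\ell_2}\sqrt{\tfrac{c_1}{\rho k_1}}\,e^{-z^2\alpha_1/\alpha_3}\Big].$$ **Theorem.** The function $H$ has a unique zero $z_0$ on $[0,\infty)$, and $z_0>0$. Set $$h_2=\tfrac{B-C}{A_\infty-B}\sqrt{\tfrac{k_2k_3c_2}{\pi c_3\alpha_3}}\,\tfrac{1}{\mathrm{erf}\left(z_0\sqrt{\alpha_1/\alpha_2}\right)},\qquad q_2=\tfrac{k_2(B-C)}{\sqrt{\alpha_2\pi}\,\mathrm{erf}\left(z_0\sqrt{\alpha_1/\alpha_2}\right)}.$$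 (a) Let $A_\infty>B$ and $h_0>h_2$. Then (P1) has a unique solution, and its free boundary parameters are determined as follows: $\xi_1$ is the unique root of $Q(z)=T(\sigma(z))$ in $(z_0,\infty)$, and $\xi_2=\sigma(\xi_1)$. If $$\frac{(A_\infty-B)h_0}{1+\frac{h_0\sqrt{\pi\alpha_3}}{k_3}\,\mathrm{erf}\left(\xi_2\sqrt{\alpha_1/\alpha_3}\right)}>q_2,$$ then (P3), with $q_0$ equal to the left-hand side of this inequality, has a unique solution, and it coincides with the solution of (P1): same temperatures and same free boundaries. (b) Let $q_0>q_2$. Then (P3) has a unique solution, and its free boundary parameters are determined as follows: $\lambda_1$ is the unique root of $Q(z)=P(\sigma(z))$ in $(z_0,\infty)$, and $\lambda_2=\sigma(\lambda_1)$. For every $A_\infty>B$ such that $$\frac{q_0}{(A_\infty-B)-q_0\frac{\sqrt{\pi\alpha_3}}{k_3}\,\mathrm{erf}\left(\lambda_2\sqrt{\alpha_1/\alpha_3}\right)}>h_2,$$ the problem (P1) with this $A_\infty$, and with $h_0$ equal to the left-hand side of this inequality, has a unique solution, and it coincides with the solution of (P3). -/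

import Mathlib

open Real Set Filter Topology

noncomputable section

/-- The error function `erf z = (2/√π) ∫₀ᶻ exp(-s²) ds`. -/
def erf (z : ℝ) : ℝ := 2 / √π * ∫ s in (0 : ℝ)..z, Real.exp (-s ^ 2)

/-- The complementary error function. -/
def erfc (z : ℝ) : ℝ := 1 - erf z

/-- The inverse of the error function; only meaningful on `(-1, 1)`, the range of `erf`. -/
def erfInv : ℝ → ℝ := Function.invFun erf

/-- Physical data of the three-phase material: thermal conductivities `k i`, specific heats `c i`,
common density `ρ`, latent heats per unit mass `ℓ i`, phase-change temperatures `B > C` and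
initial temperature `D < C`; the thermal diffusivities `α i = k i / (ρ * c i)` satisfy
`α 3 < α 2`. -/
structure StefanData where
  (k₁ k₂ k₃ c₁ c₂ c₃ ρ ℓ₁ ℓ₂ B C D : ℝ)
  k₁_pos : 0 < k₁
  k₂_pos : 0 < k₂
  k₃_pos : 0 < k₃
  c₁_pos : 0 < c₁
  c₂_pos : 0 < c₂
  c₃_pos : 0 < c₃
  ρ_pos : 0 < ρ
  ℓ₁_pos : 0 < ℓ₁
  ℓ₂_pos : 0 < ℓ₂
  C_lt_B : C < B
  D_lt_C : D < C
  diffusivity_lt : k₃ / (ρ * c₃) < k₂ / (ρ * c₂)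

/-- A candidate solution: the temperatures `Φᵢ x t` of the three phases and the free boundaries
`y₂` (between phases 3 and 2) and `y₁` (between phases 2 and 1). The temperature `Φ₃` only matters
for `0 ≤ x ≤ y₂ t`, `Φ₂` for `y₂ t ≤ x ≤ y₁ t` and `Φ₁` for `y₁ t ≤ x`, where `0 < t`. -/
structure ThreePhase where
  (Φ₁ Φ₂ Φ₃ : ℝ → ℝ → ℝ)
  (y₁ y₂ : ℝ → ℝ)

namespace ThreePhase

/-- Two candidates coincide: same free boundaries, and same temperatures in each phase
(up to the boundary of the phase). -/
structure Coincides (S S' : ThreePhase) : Prop where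
  y₁_eq : ∀ t, 0 ≤ t → S.y₁ t = S'.y₁ t
  y₂_eq : ∀ t, 0 ≤ t → S.y₂ t = S'.y₂ t
  Φ₃_eq : ∀ x t, 0 < t → 0 ≤ x → x ≤ S.y₂ t → S.Φ₃ x t = S'.Φ₃ x t
  Φ₂_eq : ∀ x t, 0 < t → S.y₂ t ≤ x → x ≤ S.y₁ t → S.Φ₂ x t = S'.Φ₂ x t
  Φ₁_eq : ∀ x t, 0 < t → S.y₁ t ≤ x → S.Φ₁ x t = S'.Φ₁ x t

end ThreePhase

/-- `u` satisfies `∂u/∂t = α ∂²u/∂x²` at the point `(x, t)`, in the classical sense. -/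
def HeatEqAt (α : ℝ) (u : ℝ → ℝ → ℝ) (x t : ℝ) : Prop :=
  DifferentiableAt ℝ (fun s => u x s) t ∧ ContDiffAt ℝ 2 (fun z => u z t) x ∧
    deriv (fun s => u x s) t = α * iteratedDeriv 2 (fun z => u z t) x

namespace StefanData

variable (m : StefanData)

/-! ### Derived constants -/

/-- Thermal diffusivities. -/
def α₁ : ℝ := m.k₁ / (m.ρ * m.c₁)
def α₂ : ℝ := m.k₂ / (m.ρ * m.c₂)
def α₃ : ℝ := m.k₃ / (m.ρ * m.c₃)

/-- Latent heats per unit volume. -/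
def δ₁ : ℝ := m.ρ * m.ℓ₁
def δ₂ : ℝ := m.ρ * m.ℓ₂

/-- Stefan numbers. -/
def Ste₁ : ℝ := m.c₁ * (m.C - m.D) / m.ℓ₁
def Ste₂ : ℝ := m.c₂ * (m.B - m.C) / m.ℓ₂

/-! ### The free boundary problems -/

/-- The conditions common to all the three-phase problems (everything except the condition imposed
at the fixed face `x = 0`). Derivatives at the free boundaries are one-sided, taken from within
the phase; the initial temperature is attained as `t → 0⁺`. -/
structure SolvesStefan (S : ThreePhase) : Prop where
  y₂_cont : ContinuousOn S.y₂ (Ici 0)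
  y₁_cont : ContinuousOn S.y₁ (Ici 0)
  y₂_zero : S.y₂ 0 = 0
  y₁_zero : S.y₁ 0 = 0
  y₂_pos : ∀ t, 0 < t → 0 < S.y₂ t
  y₂_lt_y₁ : ∀ t, 0 < t → S.y₂ t < S.y₁ t
  Φ₃_cont : ContinuousOn (fun p : ℝ × ℝ => S.Φ₃ p.1 p.2)
    {p | 0 < p.2 ∧ 0 ≤ p.1 ∧ p.1 ≤ S.y₂ p.2}
  Φ₂_cont : ContinuousOn (fun p : ℝ × ℝ => S.Φ₂ p.1 p.2)
    {p | 0 < p.2 ∧ S.y₂ p.2 ≤ p.1 ∧ p.1 ≤ S.y₁ p.2}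
  Φ₁_cont : ContinuousOn (fun p : ℝ × ℝ => S.Φ₁ p.1 p.2) {p | 0 < p.2 ∧ S.y₁ p.2 ≤ p.1}
  heat₃ : ∀ x t, 0 < t → 0 < x → x < S.y₂ t → HeatEqAt m.α₃ S.Φ₃ x t
  heat₂ : ∀ x t, 0 < t → S.y₂ t < x → x < S.y₁ t → HeatEqAt m.α₂ S.Φ₂ x t
  heat₁ : ∀ x t, 0 < t → S.y₁ t < x → HeatEqAt m.α₁ S.Φ₁ x t
  Φ₃_eq_B : ∀ t, 0 < t → S.Φ₃ (S.y₂ t) t = m.B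
  Φ₂_eq_B : ∀ t, 0 < t → S.Φ₂ (S.y₂ t) t = m.B
  Φ₂_eq_C : ∀ t, 0 < t → S.Φ₂ (S.y₁ t) t = m.C
  Φ₁_eq_C : ∀ t, 0 < t → S.Φ₁ (S.y₁ t) t = m.C
  initial : ∀ x, 0 < x → Tendsto (fun t => S.Φ₁ x t) (𝓝[>] 0) (𝓝 m.D)
  atInfinity : ∀ t, 0 < t → Tendsto (fun x => S.Φ₁ x t) atTop (𝓝 m.D)
  stefan₂ : ∀ t, 0 < t → ∃ g₂ g₃ v : ℝ,
    HasDerivWithinAt (fun x => S.Φ₂ x t) g₂ (Icc (S.y₂ t) (S.y₁ t)) (S.y₂ t) ∧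
    HasDerivWithinAt (fun x => S.Φ₃ x t) g₃ (Icc 0 (S.y₂ t)) (S.y₂ t) ∧
    HasDerivAt S.y₂ v t ∧ m.k₂ * g₂ - m.k₃ * g₃ = m.δ₂ * v
  stefan₁ : ∀ t, 0 < t → ∃ g₁ g₂ v : ℝ,
    HasDerivWithinAt (fun x => S.Φ₁ x t) g₁ (Ici (S.y₁ t)) (S.y₁ t) ∧
    HasDerivWithinAt (fun x => S.Φ₂ x t) g₂ (Icc (S.y₂ t) (S.y₁ t)) (S.y₁ t) ∧
    HasDerivAt S.y₁ v t ∧ m.k₁ * g₁ - m.k₂ * g₂ = m.δ₁ * v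

/-- Robin (convective) condition `k₃ ∂Φ₃/∂x (0,t) = (h₀/√t) (Φ₃(0,t) - A∞)`. -/
def RobinCondition (h₀ Ainf : ℝ) (S : ThreePhase) : Prop :=
  ∀ t, 0 < t → ∃ g : ℝ, HasDerivWithinAt (fun x => S.Φ₃ x t) g (Icc 0 (S.y₂ t)) 0 ∧
    m.k₃ * g = h₀ / √t * (S.Φ₃ 0 t - Ainf)

/-- Neumann (flux) condition `k₃ ∂Φ₃/∂x (0,t) = -q₀/√t`. -/
def NeumannCondition (q₀ : ℝ) (S : ThreePhase) : Prop :=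
  ∀ t, 0 < t → ∃ g : ℝ, HasDerivWithinAt (fun x => S.Φ₃ x t) g (Icc 0 (S.y₂ t)) 0 ∧
    m.k₃ * g = -(q₀ / √t)

/-- `S` is of similarity type, its free boundaries being `yᵢ(t) = 2 ξᵢ √(α₁ t)`. -/
structure HasSimilarityForm (S : ThreePhase) (ξ₁ ξ₂ : ℝ) : Prop where
  ξ₁_pos : 0 < ξ₁
  ξ₂_pos : 0 < ξ₂
  y₁_eq : ∀ t, 0 ≤ t → S.y₁ t = 2 * ξ₁ * √(m.α₁ * t)
  y₂_eq : ∀ t, 0 ≤ t → S.y₂ t = 2 * ξ₂ * √(m.α₁ * t)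
  Φ₃_eq : ∃ a b : ℝ, ∀ x t, 0 < t → 0 ≤ x → x ≤ S.y₂ t →
    S.Φ₃ x t = a + b * erf (x / (2 * √(m.α₃ * t)))
  Φ₂_eq : ∃ a b : ℝ, ∀ x t, 0 < t → S.y₂ t ≤ x → x ≤ S.y₁ t →
    S.Φ₂ x t = a + b * erf (x / (2 * √(m.α₂ * t)))
  Φ₁_eq : ∃ a b : ℝ, ∀ x t, 0 < t → S.y₁ t ≤ x →
    S.Φ₁ x t = a + b * erf (x / (2 * √(m.α₁ * t)))

/-- `S` is a similarity-type solution of the problem with the Robin condition. -/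
def SolvesRobin (h₀ Ainf : ℝ) (S : ThreePhase) : Prop :=
  m.SolvesStefan S ∧ m.RobinCondition h₀ Ainf S ∧ ∃ ξ₁ ξ₂, m.HasSimilarityForm S ξ₁ ξ₂

/-- `S` is a similarity-type solution of the problem with the Neumann condition. -/
def SolvesNeumann (q₀ : ℝ) (S : ThreePhase) : Prop :=
  m.SolvesStefan S ∧ m.NeumannCondition q₀ S ∧ ∃ ξ₁ ξ₂, m.HasSimilarityForm S ξ₁ ξ₂

/-- `S` is *the* solution of the Robin problem. -/
def IsTheRobinSolution (h₀ Ainf : ℝ) (S : ThreePhase) : Prop :=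
  m.SolvesRobin h₀ Ainf S ∧ ∀ S', m.SolvesRobin h₀ Ainf S' → S'.Coincides S

/-- `S` is *the* solution of the Neumann problem. -/
def IsTheNeumannSolution (q₀ : ℝ) (S : ThreePhase) : Prop :=
  m.SolvesNeumann q₀ S ∧ ∀ S', m.SolvesNeumann q₀ S' → S'.Coincides S

/-! ### The equations for the dimensionless parameters of the free boundaries -/

def φ (z : ℝ) : ℝ := z + m.Ste₁ / √π * (exp (-z ^ 2) / erfc z)

def H (z : ℝ) : ℝ :=
  erf (z * √(m.α₁ / m.α₂)) -
    m.Ste₂ / √π * (m.ℓ₂ / m.ℓ₁) * √(m.k₂ * m.c₁ / (m.k₁ * m.c₂)) *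
      (exp (-z ^ 2 * (m.α₁ / m.α₂)) / m.φ z)

def Q (z : ℝ) : ℝ := m.ℓ₁ / m.ℓ₂ * m.φ z * exp (z ^ 2 * (m.α₁ / m.α₂))

/-- The parameter of the second free boundary as a function of that of the first one. -/
def second (z : ℝ) : ℝ := √(m.α₂ / m.α₁) * erfInv (m.H z)

def T (h₀ Ainf z : ℝ) : ℝ :=
  m.Ste₂ / (√π * m.c₂) * ((Ainf - m.B) / (m.B - m.C)) * √(m.k₃ * m.c₁ * m.c₃ / m.k₁) *
      (exp (-z ^ 2 * m.α₁ * (1 / m.α₃ - 1 / m.α₂)) /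
        (m.k₃ / (h₀ * √(π * m.α₃)) + erf (z * √(m.α₁ / m.α₃)))) -
    z * exp (z ^ 2 * (m.α₁ / m.α₂))

def U (h₀ Ainf z : ℝ) : ℝ := m.T h₀ Ainf (m.second z)

def P (q₀ z : ℝ) : ℝ :=
  exp (z ^ 2 * (m.α₁ / m.α₂)) *
    (-z + q₀ / m.ℓ₂ * √(m.c₁ / (m.ρ * m.k₁)) * exp (-z ^ 2 * (m.α₁ / m.α₃)))

/-- `ξ₁` is the unique root of `Q = U` in `(z₀, ∞)` and `ξ₂ = √(α₂/α₁) erf⁻¹(H(ξ₁))`. -/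
def RobinParameters (z₀ h₀ Ainf ξ₁ ξ₂ : ℝ) : Prop :=
  (∀ z, z₀ < z → (m.Q z = m.U h₀ Ainf z ↔ z = ξ₁)) ∧ z₀ < ξ₁ ∧ ξ₂ = m.second ξ₁

/-- `l₁` is the unique root of `Q(z) = P(√(α₂/α₁) erf⁻¹(H(z)))` in `(z₀, ∞)` and
`l₂ = √(α₂/α₁) erf⁻¹(H(l₁))`. -/
def NeumannParameters (z₀ q₀ l₁ l₂ : ℝ) : Prop :=
  (∀ z, z₀ < z → (m.Q z = m.P q₀ (m.second z) ↔ z = l₁)) ∧ z₀ < l₁ ∧ l₂ = m.second l₁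

/-! ### Thresholds and the relations between the data -/

def h₂ (z₀ Ainf : ℝ) : ℝ :=
  (m.B - m.C) / (Ainf - m.B) * √(m.k₂ * m.k₃ * m.c₂ / (π * m.c₃ * m.α₃)) *
    (1 / erf (z₀ * √(m.α₁ / m.α₂)))

def q₂ (z₀ : ℝ) : ℝ :=
  m.k₂ * (m.B - m.C) / (√(m.α₂ * π) * erf (z₀ * √(m.α₁ / m.α₂)))

/-- The flux coefficient associated with the Robin data. -/
def fluxOfRobin (h₀ Ainf ξ₂ : ℝ) : ℝ :=
  (Ainf - m.B) * h₀ / (1 + h₀ * √(π * m.α₃) / m.k₃ * erf (ξ₂ * √(m.α₁ / m.α₃)))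

/-- The heat transfer coefficient associated with the Neumann datum and a bulk temperature. -/
def robinOfFlux (q₀ Ainf l₂ : ℝ) : ℝ :=
  q₀ / ((Ainf - m.B) - q₀ * (√(π * m.α₃) / m.k₃) * erf (l₂ * √(m.α₁ / m.α₃)))

end StefanData

end

/-! The similarity ansatz turns the problem into algebra. The values B, C, D fix every coefficient
except the slope in phase 3, which is recorded as a flux q at the face (`exists_similarity`). The
Stefan conditions then become H(ξ₁) = erf(ξ₂ √(α₁/α₂)), that is ξ₂ = σ(ξ₁), and Q(ξ₁) = P_q(ξ₂)
(`stefan₁_iff`, `stefan₂_iff`).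

Monotonicity solves this system. By the Mills ratio bound exp(-z²)/erfc(z) is nondecreasing, so φ, H
and Q increase strictly. H rises from a negative value to 1, and ξ₂ > 0 forces ξ₁ > z₀; beyond z₀, σ
increases from 0. Since α₃ < α₂, P_q decreases for q ≥ 0. As Q tends to infinity, Q and P_q ∘ σ
cross exactly once when Q(z₀) < P_q(0), which means q > q₂ (`exists_root`, `Q_zero`).

The Neumann condition says q = q₀. The Robin condition says that q is `fluxOfRobin` at ξ₂, which
does not increase with ξ₂, and T(z) is P at z with this flux (`T_eq_P`). So T decreases as well, and
h₀ > h₂ is the same threshold, since h₂ = q₂/(A∞ - B). When the data of the two problems are related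
through `fluxOfRobin`, a root of one equation is a root of the other; uniqueness of roots makes the
parameters, hence the solutions, equal. -/

/-! ### The error function -/

theorem continuous_exp_neg_sq : Continuous fun s : ℝ => Real.exp (-s ^ 2) := by fun_prop

theorem hasDerivAt_erf (x : ℝ) : HasDerivAt erf (2 / √π * Real.exp (-x ^ 2)) x :=
  ((continuous_exp_neg_sq.integral_hasStrictDerivAt 0 x).hasDerivAt).const_mul _

theorem differentiable_erf : Differentiable ℝ erf := fun x => (hasDerivAt_erf x).differentiableAt

theorem continuous_erf : Continuous erf := differentiable_erf.continuous

theorem deriv_erf : deriv erf = fun x => 2 / √π * Real.exp (-x ^ 2) :=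
  funext fun x => (hasDerivAt_erf x).deriv

theorem contDiff_two_erf : ContDiff ℝ 2 erf := by
  rw [show (2 : WithTop ℕ∞) = 1 + 1 by norm_num, contDiff_succ_iff_deriv]
  refine ⟨differentiable_erf, by simp, ?_⟩
  rw [deriv_erf]
  fun_prop

theorem strictMono_erf : StrictMono erf :=
  strictMono_of_deriv_pos fun x => by
    rw [deriv_erf]
    positivity

@[simp] theorem erf_zero : erf 0 = 0 := by simp [erf]

theorem erf_pos {z : ℝ} (hz : 0 < z) : 0 < erf z := by
  simpa using strictMono_erf hz

theorem erf_nonneg {z : ℝ} (hz : 0 ≤ z) : 0 ≤ erf z := by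
  simpa using strictMono_erf.monotone hz

theorem tendsto_erf_atTop : Tendsto erf atTop (𝓝 1) := by
  have hi : MeasureTheory.IntegrableOn (fun s : ℝ => Real.exp (-s ^ 2)) (Ioi 0) := by
    simpa using (integrable_exp_neg_mul_sq (b := 1) one_pos).integrableOn
  have h := MeasureTheory.intervalIntegral_tendsto_integral_Ioi 0 hi tendsto_id
  have hg : ∫ s in Ioi (0 : ℝ), Real.exp (-s ^ 2) = √π / 2 := by
    simpa using integral_gaussian_Ioi 1
  rw [hg] at h
  have h' := h.const_mul (2 / √π)
  have : 2 / √π * (√π / 2) = 1 := by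
    have : √π ≠ 0 := by positivity
    field_simp
  rw [this] at h'
  exact h'

theorem erf_lt_one (z : ℝ) : erf z < 1 :=
  (strictMono_erf (lt_add_one z)).trans_le
    (strictMono_erf.monotone.ge_of_tendsto tendsto_erf_atTop _)

theorem erfc_pos (z : ℝ) : 0 < erfc z := sub_pos.2 (erf_lt_one z)

theorem erfInv_erf (z : ℝ) : erfInv (erf z) = z :=
  Function.leftInverse_invFun strictMono_erf.injective z

theorem erf_erfInv {y : ℝ} (h0 : 0 ≤ y) (h1 : y < 1) : erf (erfInv y) = y := by
  obtain ⟨b, hb0, hb⟩ : ∃ b, 0 ≤ b ∧ y < erf b :=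
    ((eventually_ge_atTop 0).and (tendsto_erf_atTop.eventually_const_lt h1)).exists
  obtain ⟨x, -, hx⟩ := intermediate_value_Icc hb0 continuous_erf.continuousOn
    (show y ∈ Icc (erf 0) (erf b) from ⟨by simpa using h0, hb.le⟩)
  exact Function.invFun_eq ⟨x, hx⟩

/-- The Mills ratio bound. -/
theorem erfc_lt {z : ℝ} (hz : 0 < z) : erfc z < Real.exp (-z ^ 2) / (z * √π) := by
  have hpi : 0 < √π := by positivity
  -- The difference of the two sides is strictly increasing and tends to 0 at infinity, so it is
  -- negative.
  set f : ℝ → ℝ := fun z => erfc z - Real.exp (-z ^ 2) / (z * √π) with hf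
  have hd : ∀ x, 0 < x → HasDerivAt f (Real.exp (-x ^ 2) / (x ^ 2 * √π)) x := by
    intro x hx
    have h1 : HasDerivAt erfc (-(2 / √π * Real.exp (-x ^ 2))) x :=
      (hasDerivAt_erf x).const_sub 1
    have h2 : HasDerivAt (fun x : ℝ => Real.exp (-x ^ 2)) (Real.exp (-x ^ 2) * (-(2 * x))) x := by
      simpa using ((hasDerivAt_pow 2 x).neg).exp
    have h3 : HasDerivAt (fun x : ℝ => x * √π) √π x := by
      simpa using (hasDerivAt_id x).mul_const √π
    have h4 := h1.sub (h2.div h3 (by positivity))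
    refine h4.congr_deriv ?_
    field_simp
    ring
  have hmono : StrictMonoOn f (Ioi 0) := by
    refine strictMonoOn_of_deriv_pos (convex_Ioi 0)
      (fun x hx => (hd x hx).continuousAt.continuousWithinAt) fun x hx => ?_
    rw [interior_Ioi] at hx
    have hx' : 0 < x := hx
    rw [(hd x hx).deriv]
    positivity
  have hlim : Tendsto f atTop (𝓝 0) := by
    have h1 : Tendsto erfc atTop (𝓝 0) := by
      have h := tendsto_erf_atTop.const_sub 1
      rwa [sub_self] at h
    have h2 : Tendsto (fun z : ℝ => Real.exp (-z ^ 2) / (z * √π)) atTop (𝓝 0) := by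
      have hz : Tendsto (fun z : ℝ => z * √π) atTop atTop := tendsto_id.atTop_mul_const hpi
      refine squeeze_zero' (g := fun z : ℝ => (z * √π)⁻¹) ?_ ?_ hz.inv_tendsto_atTop
      · filter_upwards [eventually_gt_atTop 0] with z hz
        positivity
      · filter_upwards [eventually_gt_atTop 0] with z hz
        rw [div_eq_mul_inv]
        exact mul_le_of_le_one_left (by positivity) (Real.exp_le_one_iff.2 (by nlinarith))
    simpa using h1.sub h2
  -- The limit only gives f ≤ 0; passing through z + 1 recovers strictness.
  have h1 : f z < f (z + 1) := hmono hz (show (0 : ℝ) < z + 1 by linarith) (by linarith)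
  have h2 : f (z + 1) ≤ 0 := by
    refine ge_of_tendsto hlim ?_
    filter_upwards [eventually_ge_atTop (z + 1)] with w hw
    exact hmono.monotoneOn (show (0 : ℝ) < z + 1 by linarith) (show (0 : ℝ) < w by linarith) hw
  have := h1.trans_le h2
  simp only [hf] at this
  linarith

theorem continuous_erfc : Continuous erfc := continuous_const.sub continuous_erf

/-- The derivative has the sign of exp(-x²) - x √π erfc(x), which is positive for x > 0 by
`erfc_lt`. -/
theorem monotoneOn_exp_neg_sq_div_erfc :
    MonotoneOn (fun z : ℝ => Real.exp (-z ^ 2) / erfc z) (Ici 0) := by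
  have hd : ∀ x, HasDerivAt (fun z : ℝ => Real.exp (-z ^ 2) / erfc z)
      ((Real.exp (-x ^ 2) * (-(2 * x)) * erfc x -
        Real.exp (-x ^ 2) * (-(2 / √π * Real.exp (-x ^ 2)))) / erfc x ^ 2) x := by
    intro x
    have h1 : HasDerivAt erfc (-(2 / √π * Real.exp (-x ^ 2))) x :=
      (hasDerivAt_erf x).const_sub 1
    have h2 : HasDerivAt (fun x : ℝ => Real.exp (-x ^ 2)) (Real.exp (-x ^ 2) * (-(2 * x))) x := by
      simpa using ((hasDerivAt_pow 2 x).neg).exp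
    exact h2.div h1 (erfc_pos x).ne'
  refine monotoneOn_of_deriv_nonneg (convex_Ici 0)
    (fun x _ => (hd x).continuousAt.continuousWithinAt)
    (fun x _ => (hd x).differentiableAt.differentiableWithinAt) fun x hx => ?_
  rw [interior_Ici] at hx
  have hx' : 0 < x := hx
  rw [(hd x).deriv]
  have h := erfc_lt hx'
  rw [lt_div_iff₀ (by positivity)] at h
  have hpi : 0 < √π := by positivity
  have h2 : 0 ≤ 2 / √π * Real.exp (-x ^ 2) - 2 * x * erfc x := by
    have : 2 / √π * Real.exp (-x ^ 2) - 2 * x * erfc x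
        = 2 / √π * (Real.exp (-x ^ 2) - erfc x * (x * √π)) := by
      field_simp
    rw [this]
    exact mul_nonneg (by positivity) (by linarith)
  refine div_nonneg ?_ (sq_nonneg _)
  have := mul_nonneg (Real.exp_pos (-x ^ 2)).le h2
  linarith

/-- `erf` is a topological embedding, so continuity may be tested after composing with it, which
gives back f. -/
theorem continuousOn_erfInv_comp {f : ℝ → ℝ} {s : Set ℝ} (hf : ContinuousOn f s)
    (h : ∀ z ∈ s, 0 ≤ f z ∧ f z < 1) : ContinuousOn (fun z => erfInv (f z)) s := by
  have he : IsEmbedding erf := strictMono_erf.isEmbedding_of_ordConnected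
    (hc := (isPreconnected_range continuous_erf).ordConnected)
  rw [he.isInducing.continuousOn_iff]
  exact hf.congr fun z hz => erf_erfInv (h z hz).1 (h z hz).2

/-! ### Similarity profiles -/

/-- The self-similar solution `a + b erf(x / (2 √(α t)))` of the heat equation. -/
noncomputable def erfProfile (α a b : ℝ) (x t : ℝ) : ℝ := a + b * erf (x / (2 * √(α * t)))

theorem hasDerivAt_erfProfile (α a b x t : ℝ) :
    HasDerivAt (fun x => erfProfile α a b x t)
      (b * (Real.exp (-(x / (2 * √(α * t))) ^ 2) / (√π * √(α * t)))) x := by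
  have h := (((hasDerivAt_erf (x / (2 * √(α * t)))).comp x
    ((hasDerivAt_id x).div_const (2 * √(α * t)))).const_mul b).const_add a
  refine h.congr_deriv ?_
  -- Working with inverses avoids assuming √(α t) ≠ 0; the formula also holds under the convention x
  -- / 0 = 0.
  rw [show 2 / √π * Real.exp (-(x / (2 * √(α * t))) ^ 2) * (1 / (2 * √(α * t)))
    = (2 / 2) * (Real.exp (-(x / (2 * √(α * t))) ^ 2) / (√π * √(α * t))) by
      simp only [div_eq_mul_inv, mul_inv]; ring]
  ring

theorem heatEqAt_erfProfile {α t : ℝ} (hα : 0 < α) (ht : 0 < t) (a b x : ℝ) :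
    HeatEqAt α (erfProfile α a b) x t := by
  have hs : 0 < √(α * t) := Real.sqrt_pos.2 (by positivity)
  have hsq : √(α * t) ^ 2 = α * t := Real.sq_sqrt (by positivity)
  have ht' : HasDerivAt (fun s => erfProfile α a b x s)
      (b * (2 / √π * Real.exp (-(x / (2 * √(α * t))) ^ 2) *
        (-(x / (2 * √(α * t))) / (2 * t)))) t := by
    have h1 : HasDerivAt (fun s => α * s) α t := by simpa using (hasDerivAt_id t).const_mul α
    have h2 := (h1.sqrt (by positivity)).const_mul 2
    have h3 := (hasDerivAt_const t x).div h2 (by positivity)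
    have h4 := (((hasDerivAt_erf (x / (2 * √(α * t)))).comp t h3).const_mul b).const_add a
    refine h4.congr_deriv ?_
    congr 2
    field_simp
    rw [hsq]
    ring
  have hx2 : HasDerivAt (fun z => b * (Real.exp (-(z / (2 * √(α * t))) ^ 2) / (√π * √(α * t))))
      (b * (Real.exp (-(x / (2 * √(α * t))) ^ 2) * (-(2 * (x / (2 * √(α * t))) *
        (1 / (2 * √(α * t))))) / (√π * √(α * t)))) x := by
    have h1 := ((hasDerivAt_id x).div_const (2 * √(α * t))).pow 2
    have h2 := ((h1.neg.exp).div_const (√π * √(α * t))).const_mul b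
    refine h2.congr_deriv ?_
    simp [id]
  refine ⟨ht'.differentiableAt, ?_, ?_⟩
  · exact (contDiff_const.add (contDiff_const.mul
      (contDiff_two_erf.comp (contDiff_id.div_const _)))).contDiffAt
  · rw [ht'.deriv, iteratedDeriv_succ, iteratedDeriv_one,
      show deriv (fun z => erfProfile α a b z t) = _ from
        funext fun z => (hasDerivAt_erfProfile α a b z t).deriv, hx2.deriv]
    have hpi : √π ≠ 0 := by positivity
    -- Expressing t through √(α t) makes the identity rational in that root.
    have : 2 * t = 2 * √(α * t) ^ 2 / α := by rw [hsq]; field_simp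
    rw [this]
    field_simp

theorem continuousOn_erfProfile {α : ℝ} (hα : 0 < α) (a b : ℝ) :
    ContinuousOn (fun p : ℝ × ℝ => erfProfile α a b p.1 p.2) {p | 0 < p.2} := by
  have h : ContinuousOn (fun p : ℝ × ℝ => p.1 / (2 * √(α * p.2))) {p | 0 < p.2} := by
    refine ContinuousOn.div (by fun_prop) (by fun_prop) fun p hp => ?_
    have hp' : 0 < p.2 := hp
    have : 0 < √(α * p.2) := Real.sqrt_pos.2 (by positivity)
    positivity
  exact continuousOn_const.add (continuousOn_const.mul (continuous_erf.comp_continuousOn h))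

theorem tendsto_erfProfile_atTop {α t : ℝ} (hα : 0 < α) (ht : 0 < t) (a b : ℝ) :
    Tendsto (fun x => erfProfile α a b x t) atTop (𝓝 (a + b)) := by
  have hs : 0 < √(α * t) := Real.sqrt_pos.2 (by positivity)
  have h := ((tendsto_erf_atTop.comp (tendsto_id.atTop_div_const
    (show 0 < 2 * √(α * t) by positivity))).const_mul b).const_add a
  simpa [erfProfile, Function.comp_def] using h

theorem tendsto_erfProfile_zero {α x : ℝ} (hα : 0 < α) (hx : 0 < x) (a b : ℝ) :
    Tendsto (fun t => erfProfile α a b x t) (𝓝[>] 0) (𝓝 (a + b)) := by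
  have h0 : Tendsto (fun t => 2 * √(α * t)) (𝓝[>] 0) (𝓝[>] 0) := by
    refine tendsto_nhdsWithin_iff.2 ⟨?_, ?_⟩
    · have : ContinuousAt (fun t => 2 * √(α * t)) 0 := by fun_prop
      simpa using this.tendsto.mono_left nhdsWithin_le_nhds
    · filter_upwards [self_mem_nhdsWithin] with t ht
      have ht' : 0 < t := ht
      have : 0 < √(α * t) := Real.sqrt_pos.2 (by positivity)
      exact mem_Ioi.2 (by positivity)
  have h1 : Tendsto (fun t => x / (2 * √(α * t))) (𝓝[>] 0) atTop := by
    simpa [div_eq_mul_inv] using h0.inv_tendsto_nhdsGT_zero.const_mul_atTop hx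
  have h := ((tendsto_erf_atTop.comp h1).const_mul b).const_add a
  simpa [erfProfile, Function.comp_def] using h

namespace StefanData

variable (m : StefanData)

/-! ### Relations between the constants -/

theorem α₁_pos : 0 < m.α₁ := div_pos m.k₁_pos (mul_pos m.ρ_pos m.c₁_pos)
theorem α₂_pos : 0 < m.α₂ := div_pos m.k₂_pos (mul_pos m.ρ_pos m.c₂_pos)
theorem α₃_pos : 0 < m.α₃ := div_pos m.k₃_pos (mul_pos m.ρ_pos m.c₃_pos)
theorem sqrt_α₁_pos : 0 < √m.α₁ := Real.sqrt_pos.2 m.α₁_pos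
theorem sqrt_α₂_pos : 0 < √m.α₂ := Real.sqrt_pos.2 m.α₂_pos
theorem sqrt_α₃_pos : 0 < √m.α₃ := Real.sqrt_pos.2 m.α₃_pos
theorem δ₁_pos : 0 < m.δ₁ := mul_pos m.ρ_pos m.ℓ₁_pos
theorem δ₂_pos : 0 < m.δ₂ := mul_pos m.ρ_pos m.ℓ₂_pos

theorem α₃_lt_α₂ : m.α₃ < m.α₂ := m.diffusivity_lt

/-- Eliminating the conductivities in favour of √αᵢ makes the square roots of the data rational
expressions. -/
theorem k₁_eq : m.k₁ = m.ρ * m.c₁ * √m.α₁ ^ 2 := by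
  have := m.ρ_pos
  have := m.c₁_pos
  rw [Real.sq_sqrt m.α₁_pos.le, α₁]
  field_simp

theorem k₂_eq : m.k₂ = m.ρ * m.c₂ * √m.α₂ ^ 2 := by
  have := m.ρ_pos
  have := m.c₂_pos
  rw [Real.sq_sqrt m.α₂_pos.le, α₂]
  field_simp

theorem k₃_eq : m.k₃ = m.ρ * m.c₃ * √m.α₃ ^ 2 := by
  have := m.ρ_pos
  have := m.c₃_pos
  rw [Real.sq_sqrt m.α₃_pos.le, α₃]
  field_simp

theorem ratio₂_pos : 0 < √(m.α₁ / m.α₂) := Real.sqrt_pos.2 (div_pos m.α₁_pos m.α₂_pos)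
theorem ratio₃_pos : 0 < √(m.α₁ / m.α₃) := Real.sqrt_pos.2 (div_pos m.α₁_pos m.α₃_pos)

/-- The coefficient in the second term of `H`. -/
noncomputable def κ : ℝ := m.k₂ * (m.B - m.C) / (√π * √m.α₂ * m.δ₁ * √m.α₁)

theorem κ_pos : 0 < m.κ := by
  have := m.k₂_pos
  have := sub_pos.2 m.C_lt_B
  have := m.sqrt_α₁_pos
  have := m.sqrt_α₂_pos
  have := m.δ₁_pos
  unfold κ
  positivity

theorem κ_eq : m.Ste₂ / √π * (m.ℓ₂ / m.ℓ₁) * √(m.k₂ * m.c₁ / (m.k₁ * m.c₂)) = m.κ := by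
  have h1 := m.sqrt_α₁_pos
  have h2 := m.sqrt_α₂_pos
  have := m.ρ_pos
  have := m.c₁_pos
  have := m.c₂_pos
  have := m.ℓ₁_pos
  have := m.ℓ₂_pos
  have hs : √(m.k₂ * m.c₁ / (m.k₁ * m.c₂)) = √m.α₂ / √m.α₁ := by
    rw [Real.sqrt_eq_iff_mul_self_eq_of_pos (by positivity)]
    rw [m.k₁_eq, m.k₂_eq]
    field_simp
  rw [hs, κ, Ste₂, δ₁, m.k₂_eq]
  field_simp

theorem H_eq (z : ℝ) : m.H z =
    erf (z * √(m.α₁ / m.α₂)) - m.κ * (Real.exp (-z ^ 2 * (m.α₁ / m.α₂)) / m.φ z) := by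
  rw [H, κ_eq]

/-- In this form the decrease of P is visible: α₁/α₃ - α₁/α₂ is positive because α₃ < α₂. -/
theorem P_eq (q₀ z : ℝ) : m.P q₀ z = q₀ / (m.δ₂ * √m.α₁) *
    Real.exp (-z ^ 2 * (m.α₁ / m.α₃ - m.α₁ / m.α₂)) - z * Real.exp (z ^ 2 * (m.α₁ / m.α₂)) := by
  have h1 := m.sqrt_α₁_pos
  have := m.ρ_pos
  have := m.c₁_pos
  have := m.ℓ₂_pos
  have hs : √(m.c₁ / (m.ρ * m.k₁)) = 1 / (m.ρ * √m.α₁) := by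
    rw [Real.sqrt_eq_iff_mul_self_eq_of_pos (by positivity)]
    rw [m.k₁_eq]
    field_simp
  have he : Real.exp (-z ^ 2 * (m.α₁ / m.α₃ - m.α₁ / m.α₂)) =
      Real.exp (z ^ 2 * (m.α₁ / m.α₂)) * Real.exp (-z ^ 2 * (m.α₁ / m.α₃)) := by
    rw [← Real.exp_add]
    ring_nf
  rw [P, hs, he, δ₂]
  field_simp
  ring

theorem sqrt_pi_mul_α₃ : √(π * m.α₃) = √π * √m.α₃ := Real.sqrt_mul pi_pos.le _

theorem fluxOfRobin_den_pos {h₀ ξ : ℝ} (hh : 0 < h₀) (hξ : 0 ≤ ξ) :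
    0 < 1 + h₀ * √(π * m.α₃) / m.k₃ * erf (ξ * √(m.α₁ / m.α₃)) := by
  have := m.k₃_pos
  have := erf_nonneg (mul_nonneg hξ m.ratio₃_pos.le)
  positivity

/-- The Robin problem is the Neumann problem with the associated flux coefficient. -/
theorem T_eq_P {h₀ Ainf z : ℝ} (hh : 0 < h₀) (hz : 0 ≤ z) :
    m.T h₀ Ainf z = m.P (m.fluxOfRobin h₀ Ainf z) z := by
  have hd := m.fluxOfRobin_den_pos hh hz
  rw [P_eq, T, fluxOfRobin]
  rw [sqrt_pi_mul_α₃] at *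
  have h1 := m.sqrt_α₁_pos
  have h3 := m.sqrt_α₃_pos
  have hρ := m.ρ_pos
  have := m.c₁_pos
  have := m.c₂_pos
  have hc3 := m.c₃_pos
  have := m.ℓ₂_pos
  have := m.α₂_pos
  have := m.α₃_pos
  have hBC := sub_pos.2 m.C_lt_B
  have hpi : 0 < √π := by positivity
  have hs : √(m.k₃ * m.c₁ * m.c₃ / m.k₁) = m.c₃ * √m.α₃ / √m.α₁ := by
    rw [Real.sqrt_eq_iff_mul_self_eq_of_pos (by positivity)]
    rw [m.k₁_eq, m.k₃_eq]
    field_simp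
  have he : -z ^ 2 * m.α₁ * (1 / m.α₃ - 1 / m.α₂) =
      -z ^ 2 * (m.α₁ / m.α₃ - m.α₁ / m.α₂) := by ring
  have hk : 0 < m.k₃ := m.k₃_pos
  rw [hs, he, δ₂, Ste₂]
  congr 1
  set e := erf (z * √(m.α₁ / m.α₃))
  -- The denominators of T and of the flux differ by the factor k₃ / (h₀ √(π α₃)).
  have hd' : m.k₃ / (h₀ * (√π * √m.α₃)) + e =
      (1 + h₀ * (√π * √m.α₃) / m.k₃ * e) * (m.k₃ / (h₀ * (√π * √m.α₃))) := by
    field_simp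
  rw [hd']
  generalize 1 + h₀ * (√π * √m.α₃) / m.k₃ * e = d at *
  rw [m.k₃_eq]
  field_simp

/-! ### Monotonicity and continuity -/

theorem φ_eq_add (z : ℝ) : m.φ z = z + m.Ste₁ / √π * (Real.exp (-z ^ 2) / erfc z) := rfl

theorem Ste₁_pos : 0 < m.Ste₁ :=
  div_pos (mul_pos m.c₁_pos (sub_pos.2 m.D_lt_C)) m.ℓ₁_pos

theorem lt_φ (z : ℝ) : z < m.φ z := by
  have := m.Ste₁_pos
  have := erfc_pos z
  exact lt_add_of_pos_right _ (by positivity)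

theorem φ_pos {z : ℝ} (hz : 0 ≤ z) : 0 < m.φ z := hz.trans_lt (m.lt_φ z)

theorem strictMonoOn_φ : StrictMonoOn m.φ (Ici 0) := by
  intro x hx y hy hxy
  have h := monotoneOn_exp_neg_sq_div_erfc hx hy hxy.le
  have := m.Ste₁_pos
  exact add_lt_add_of_lt_of_le hxy (mul_le_mul_of_nonneg_left h (by positivity))

theorem continuous_φ : Continuous m.φ :=
  continuous_id.add (continuous_const.mul
    (continuous_exp_neg_sq.div continuous_erfc fun z => (erfc_pos z).ne'))

theorem continuousOn_H : ContinuousOn m.H (Ici 0) := by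
  have h : ContinuousOn (fun z => erf (z * √(m.α₁ / m.α₂)) -
      m.κ * (Real.exp (-z ^ 2 * (m.α₁ / m.α₂)) / m.φ z)) (Ici 0) :=
    (continuous_erf.comp (by fun_prop)).continuousOn.sub (continuousOn_const.mul
      (ContinuousOn.div (by fun_prop) m.continuous_φ.continuousOn
        fun z hz => (m.φ_pos hz).ne'))
  exact h.congr fun z _ => m.H_eq z

theorem strictMonoOn_H : StrictMonoOn m.H (Ici 0) := by
  intro x hx y hy hxy
  have hx' : 0 ≤ x := hx
  have h12 := div_pos m.α₁_pos m.α₂_pos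
  rw [H_eq, H_eq]
  have h1 : erf (x * √(m.α₁ / m.α₂)) < erf (y * √(m.α₁ / m.α₂)) :=
    strictMono_erf (mul_lt_mul_of_pos_right hxy m.ratio₂_pos)
  have h2 : Real.exp (-y ^ 2 * (m.α₁ / m.α₂)) / m.φ y ≤
      Real.exp (-x ^ 2 * (m.α₁ / m.α₂)) / m.φ x := by
    refine div_le_div₀ (Real.exp_pos _).le (Real.exp_le_exp.2 ?_) (m.φ_pos hx)
      (m.strictMonoOn_φ hx hy hxy).le
    exact mul_le_mul_of_nonneg_right (by nlinarith) h12.le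
  have := mul_le_mul_of_nonneg_left h2 m.κ_pos.le
  linarith

theorem H_lt_erf {z : ℝ} (hz : 0 ≤ z) : m.H z < erf (z * √(m.α₁ / m.α₂)) := by
  have := m.κ_pos
  have := m.φ_pos hz
  rw [H_eq]
  exact sub_lt_self _ (by positivity)

theorem H_lt_one {z : ℝ} (hz : 0 ≤ z) : m.H z < 1 := (m.H_lt_erf hz).trans (erf_lt_one _)

theorem tendsto_φ : Tendsto m.φ atTop atTop :=
  tendsto_atTop_mono (fun z => (m.lt_φ z).le) tendsto_id

theorem tendsto_H : Tendsto m.H atTop (𝓝 1) := by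
  have h1 : Tendsto (fun z => erf (z * √(m.α₁ / m.α₂))) atTop (𝓝 1) :=
    tendsto_erf_atTop.comp (tendsto_id.atTop_mul_const m.ratio₂_pos)
  have h2 : Tendsto (fun z => Real.exp (-z ^ 2 * (m.α₁ / m.α₂)) / m.φ z) atTop (𝓝 0) := by
    have h12 := div_pos m.α₁_pos m.α₂_pos
    refine squeeze_zero' ?_ ?_ m.tendsto_φ.inv_tendsto_atTop
    · filter_upwards [eventually_ge_atTop 0] with z hz
      exact div_nonneg (Real.exp_pos _).le (m.φ_pos hz).le
    · filter_upwards [eventually_ge_atTop 0] with z hz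
      rw [div_eq_mul_inv]
      have := m.φ_pos hz
      exact mul_le_of_le_one_left (by positivity)
        (Real.exp_le_one_iff.2 (by nlinarith [mul_nonneg (sq_nonneg z) h12.le]))
  have h3 := h1.sub (h2.const_mul m.κ)
  rw [mul_zero, sub_zero] at h3
  exact h3.congr fun z => (m.H_eq z).symm

theorem exists_zero_H : ∃ z₀, 0 < z₀ ∧ m.H z₀ = 0 := by
  have h0 : m.H 0 < 0 := by simpa using m.H_lt_erf le_rfl
  obtain ⟨b, hb0, hb⟩ : ∃ b, 0 ≤ b ∧ 0 < m.H b :=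
    ((eventually_ge_atTop 0).and (m.tendsto_H.eventually_const_lt one_pos)).exists
  obtain ⟨z, hz, hz0⟩ := intermediate_value_Icc hb0 (m.continuousOn_H.mono Icc_subset_Ici_self)
    (show (0 : ℝ) ∈ Icc (m.H 0) (m.H b) from ⟨h0.le, hb.le⟩)
  refine ⟨z, hz.1.lt_of_ne ?_, hz0⟩
  rintro rfl
  exact h0.ne hz0

theorem strictMonoOn_Q : StrictMonoOn m.Q (Ici 0) := by
  intro x hx y hy hxy
  have hx' : 0 ≤ x := hx
  have h12 := div_pos m.α₁_pos m.α₂_pos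
  have h := div_pos m.ℓ₁_pos m.ℓ₂_pos
  refine mul_lt_mul'' (mul_lt_mul_of_pos_left (m.strictMonoOn_φ hx hy hxy) h)
    (Real.exp_lt_exp.2 (mul_lt_mul_of_pos_right (by nlinarith) h12))
    (mul_nonneg h.le (m.φ_pos hx).le) (Real.exp_pos _).le

theorem continuous_Q : Continuous m.Q :=
  (continuous_const.mul m.continuous_φ).mul (by fun_prop)

theorem tendsto_Q : Tendsto m.Q atTop atTop := by
  have h12 := div_pos m.α₁_pos m.α₂_pos
  have h := div_pos m.ℓ₁_pos m.ℓ₂_pos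
  refine tendsto_atTop_mono' _ ?_ (m.tendsto_φ.const_mul_atTop h)
  filter_upwards [eventually_ge_atTop 0] with z hz
  exact le_mul_of_one_le_right (mul_nonneg h.le (m.φ_pos hz).le)
    (Real.one_le_exp (by positivity))

/-- The flux may drop together with the increase of the argument, so that the lemma covers both P,
with constant flux, and T, whose flux depends on z. -/
theorem P_lt_P {q q' x y : ℝ} (hq : 0 ≤ q') (hqq : q' ≤ q) (hx : 0 ≤ x) (hxy : x < y) :
    m.P q' y < m.P q x := by
  have h12 := div_pos m.α₁_pos m.α₂_pos
  have h3 : 0 ≤ m.α₁ / m.α₃ - m.α₁ / m.α₂ :=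
    sub_nonneg.2 (div_le_div_of_nonneg_left m.α₁_pos.le m.α₃_pos m.α₃_lt_α₂.le)
  have hδ : 0 < m.δ₂ * √m.α₁ := mul_pos m.δ₂_pos m.sqrt_α₁_pos
  have hsq : x ^ 2 < y ^ 2 := by nlinarith
  rw [P_eq, P_eq]
  have h1 : x * Real.exp (x ^ 2 * (m.α₁ / m.α₂)) < y * Real.exp (y ^ 2 * (m.α₁ / m.α₂)) :=
    mul_lt_mul'' hxy (Real.exp_lt_exp.2 (mul_lt_mul_of_pos_right hsq h12)) hx (Real.exp_pos _).le
  have h2 : q' / (m.δ₂ * √m.α₁) * Real.exp (-y ^ 2 * (m.α₁ / m.α₃ - m.α₁ / m.α₂)) ≤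
      q / (m.δ₂ * √m.α₁) * Real.exp (-x ^ 2 * (m.α₁ / m.α₃ - m.α₁ / m.α₂)) := by
    refine mul_le_mul (div_le_div_of_nonneg_right hqq hδ.le) (Real.exp_le_exp.2 ?_)
      (Real.exp_pos _).le (div_nonneg (hq.trans hqq) hδ.le)
    exact mul_le_mul_of_nonneg_right (by linarith) h3
  linarith

theorem continuous_P (q : ℝ) : Continuous (m.P q) := by
  unfold P
  fun_prop

theorem fluxOfRobin_pos {h₀ Ainf x : ℝ} (hh : 0 < h₀) (hA : m.B < Ainf) (hx : 0 ≤ x) :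
    0 < m.fluxOfRobin h₀ Ainf x :=
  div_pos (mul_pos (sub_pos.2 hA) hh) (m.fluxOfRobin_den_pos hh hx)

theorem fluxOfRobin_anti {h₀ Ainf x y : ℝ} (hh : 0 < h₀) (hA : m.B < Ainf) (hx : 0 ≤ x)
    (hxy : x ≤ y) : m.fluxOfRobin h₀ Ainf y ≤ m.fluxOfRobin h₀ Ainf x := by
  have := m.k₃_pos
  refine div_le_div_of_nonneg_left (mul_pos (sub_pos.2 hA) hh).le (m.fluxOfRobin_den_pos hh hx) ?_
  have : erf (x * √(m.α₁ / m.α₃)) ≤ erf (y * √(m.α₁ / m.α₃)) :=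
    strictMono_erf.monotone (mul_le_mul_of_nonneg_right hxy m.ratio₃_pos.le)
  gcongr

theorem strictAntiOn_P {q : ℝ} (hq : 0 ≤ q) : StrictAntiOn (m.P q) (Ici 0) :=
  fun _ hx _ _ hxy => m.P_lt_P hq le_rfl hx hxy

theorem strictAntiOn_T {h₀ Ainf : ℝ} (hh : 0 < h₀) (hA : m.B < Ainf) :
    StrictAntiOn (m.T h₀ Ainf) (Ici 0) := by
  intro x hx y hy hxy
  rw [m.T_eq_P hh hx, m.T_eq_P hh hy]
  exact m.P_lt_P (m.fluxOfRobin_pos hh hA hy).le (m.fluxOfRobin_anti hh hA hx hxy.le) hx hxy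

theorem continuousOn_T {h₀ Ainf : ℝ} (hh : 0 < h₀) : ContinuousOn (m.T h₀ Ainf) (Ici 0) := by
  have h := m.k₃_pos
  have h3 := m.α₃_pos
  unfold T
  refine ContinuousOn.sub (continuousOn_const.mul (ContinuousOn.div (by fun_prop) ?_ ?_))
    (by fun_prop)
  · exact continuousOn_const.add (continuous_erf.comp (by fun_prop)).continuousOn
  · intro z hz
    have := erf_nonneg (mul_nonneg hz m.ratio₃_pos.le)
    positivity

/-! ### The second parameter and the equation for the first one -/

variable {m} {z₀ : ℝ}

theorem H_nonneg (hz₀ : 0 < z₀) (hH : m.H z₀ = 0) {z : ℝ} (hz : z₀ ≤ z) : 0 ≤ m.H z := by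
  rw [← hH]
  exact m.strictMonoOn_H.monotoneOn hz₀.le (hz₀.le.trans hz) hz

theorem second_ratio (m : StefanData) (z : ℝ) :
    m.second z * √(m.α₁ / m.α₂) = erfInv (m.H z) := by
  have h1 := m.sqrt_α₁_pos
  have h2 := m.sqrt_α₂_pos
  rw [second, Real.sqrt_div' _ m.α₁_pos.le, Real.sqrt_div' _ m.α₂_pos.le]
  field_simp

/-- `erfInv` is a left inverse of `erf` everywhere, so this applies before ξ₁ is known to lie beyond
z₀. -/
theorem eq_second {ξ₁ ξ₂ : ℝ} (h : m.H ξ₁ = erf (ξ₂ * √(m.α₁ / m.α₂))) : ξ₂ = m.second ξ₁ := by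
  refine mul_right_cancel₀ m.ratio₂_pos.ne' ?_
  rw [second_ratio, h, erfInv_erf]

theorem erf_second (hz₀ : 0 < z₀) (hH : m.H z₀ = 0) {z : ℝ} (hz : z₀ ≤ z) :
    erf (m.second z * √(m.α₁ / m.α₂)) = m.H z := by
  rw [second_ratio, erf_erfInv (H_nonneg hz₀ hH hz) (m.H_lt_one (hz₀.le.trans hz))]

theorem second_zero (hH : m.H z₀ = 0) : m.second z₀ = 0 :=
  (eq_second (by simpa using hH)).symm

theorem strictMonoOn_second (hz₀ : 0 < z₀) (hH : m.H z₀ = 0) :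
    StrictMonoOn m.second (Ici z₀) := by
  intro x hx y hy hxy
  have h := m.strictMonoOn_H (hz₀.le.trans hx) (hz₀.le.trans hy) hxy
  rw [← erf_second hz₀ hH hx, ← erf_second hz₀ hH hy] at h
  exact lt_of_mul_lt_mul_right (strictMono_erf.lt_iff_lt.1 h) m.ratio₂_pos.le

theorem second_nonneg (hz₀ : 0 < z₀) (hH : m.H z₀ = 0) {z : ℝ} (hz : z₀ ≤ z) :
    0 ≤ m.second z := by
  rw [← second_zero hH]
  exact (strictMonoOn_second hz₀ hH).monotoneOn self_mem_Ici hz hz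

theorem second_pos (hz₀ : 0 < z₀) (hH : m.H z₀ = 0) {z : ℝ} (hz : z₀ < z) :
    0 < m.second z := by
  rw [← second_zero hH]
  exact strictMonoOn_second hz₀ hH self_mem_Ici hz.le hz

/-- Since H(z) < erf(z √(α₁/α₂)), the fronts built from σ are correctly ordered. -/
theorem second_lt (hz₀ : 0 < z₀) (hH : m.H z₀ = 0) {z : ℝ} (hz : z₀ ≤ z) :
    m.second z < z := by
  have h := m.H_lt_erf (hz₀.le.trans hz)
  rw [← erf_second hz₀ hH hz] at h
  exact lt_of_mul_lt_mul_right (strictMono_erf.lt_iff_lt.1 h) m.ratio₂_pos.le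

theorem continuousOn_second (hz₀ : 0 < z₀) (hH : m.H z₀ = 0) :
    ContinuousOn m.second (Ici z₀) :=
  continuousOn_const.mul (continuousOn_erfInv_comp
    (m.continuousOn_H.mono (Ici_subset_Ici.2 hz₀.le)) fun _ hz =>
      ⟨H_nonneg hz₀ hH hz, m.H_lt_one (hz₀.le.trans hz)⟩)

/-- The equation `Q = F ∘ second` has a unique root beyond `z₀`. -/
theorem exists_root (hz₀ : 0 < z₀) (hH : m.H z₀ = 0) {F : ℝ → ℝ} (hF : StrictAntiOn F (Ici 0))
    (hFc : ContinuousOn F (Ici 0)) (h0 : m.Q z₀ < F 0) :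
    ∃ ξ, z₀ < ξ ∧ ∀ z, z₀ < z → (m.Q z = F (m.second z) ↔ z = ξ) := by
  have hmono : StrictMonoOn (fun z => m.Q z - F (m.second z)) (Ici z₀) := by
    intro x hx y hy hxy
    have h1 := m.strictMonoOn_Q (hz₀.le.trans hx) (hz₀.le.trans hy) hxy
    have h2 := hF (second_nonneg hz₀ hH hx) (second_nonneg hz₀ hH hy)
      (strictMonoOn_second hz₀ hH hx hy hxy)
    exact sub_lt_sub h1 h2
  have hcont : ContinuousOn (fun z => m.Q z - F (m.second z)) (Ici z₀) :=
    m.continuous_Q.continuousOn.sub (hFc.comp (continuousOn_second hz₀ hH)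
      fun z hz => second_nonneg hz₀ hH hz)
  -- F 0 bounds F ∘ σ from above, so the difference is nonnegative at any such b.
  obtain ⟨b, hb0, hb⟩ : ∃ b, z₀ ≤ b ∧ F 0 < m.Q b :=
    ((eventually_ge_atTop z₀).and (m.tendsto_Q.eventually_gt_atTop (F 0))).exists
  have hFb : F (m.second b) ≤ F 0 :=
    hF.antitoneOn self_mem_Ici (second_nonneg hz₀ hH hb0) (second_nonneg hz₀ hH hb0)
  have hneg : m.Q z₀ - F (m.second z₀) < 0 := by rw [second_zero hH]; linarith
  obtain ⟨ξ, hξ, hξ0⟩ := intermediate_value_Icc hb0 (hcont.mono Icc_subset_Ici_self)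
    (show (0 : ℝ) ∈ Icc (m.Q z₀ - F (m.second z₀)) (m.Q b - F (m.second b)) from
      ⟨hneg.le, by linarith⟩)
  refine ⟨ξ, hξ.1.lt_of_ne ?_, fun z hz => ⟨fun h => ?_, ?_⟩⟩
  · rintro rfl
    exact hneg.ne hξ0
  · exact hmono.injOn hz.le hξ.1 ((sub_eq_zero.2 h).trans hξ0.symm)
  · rintro rfl
    exact sub_eq_zero.1 hξ0

/-! ### The thresholds -/

/-- H(z₀) = 0 rearranges to φ(z₀) exp(z₀² α₁/α₂) = κ / erf(z₀ √(α₁/α₂)). The right side of the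
statement is P at 0 with flux q₂, which explains the threshold. -/
theorem Q_zero (hz₀ : 0 < z₀) (hH : m.H z₀ = 0) :
    m.Q z₀ = m.q₂ z₀ / (m.δ₂ * √m.α₁) := by
  have hφ := m.φ_pos hz₀.le
  have he := erf_pos (mul_pos hz₀ m.ratio₂_pos)
  have h1 := m.sqrt_α₁_pos
  have h2 := m.sqrt_α₂_pos
  have := m.ρ_pos
  have := m.ℓ₁_pos
  have := m.ℓ₂_pos
  have hexp : Real.exp (-z₀ ^ 2 * (m.α₁ / m.α₂)) * Real.exp (z₀ ^ 2 * (m.α₁ / m.α₂)) = 1 := by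
    rw [← Real.exp_add]
    simp
  rw [H_eq, sub_eq_zero] at hH
  have h : m.φ z₀ * Real.exp (z₀ ^ 2 * (m.α₁ / m.α₂)) = m.κ / erf (z₀ * √(m.α₁ / m.α₂)) := by
    rw [eq_div_iff he.ne', hH]
    calc _ = m.κ * (Real.exp (-z₀ ^ 2 * (m.α₁ / m.α₂)) * Real.exp (z₀ ^ 2 * (m.α₁ / m.α₂)))
          * (m.φ z₀ / m.φ z₀) := by ring
      _ = m.κ := by rw [hexp, div_self hφ.ne', mul_one, mul_one]
  rw [Q, mul_assoc, h, q₂, κ, mul_comm m.α₂, Real.sqrt_mul pi_pos.le, δ₁, δ₂]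
  field_simp

theorem q₂_pos (hz₀ : 0 < z₀) : 0 < m.q₂ z₀ := by
  have := m.k₂_pos
  have := sub_pos.2 m.C_lt_B
  have := m.α₂_pos
  have := erf_pos (mul_pos hz₀ m.ratio₂_pos)
  unfold q₂
  positivity

/-- The phase 3 data cancel because k₃ / (c₃ α₃) = ρ. -/
theorem h₂_eq (hz₀ : 0 < z₀) {Ainf : ℝ} (hA : m.B < Ainf) :
    m.h₂ z₀ Ainf = m.q₂ z₀ / (Ainf - m.B) := by
  have := sub_pos.2 hA
  have := m.ρ_pos
  have := m.c₂_pos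
  have := m.c₃_pos
  have h2 := m.sqrt_α₂_pos
  have h3 := m.α₃_pos
  have he := erf_pos (mul_pos hz₀ m.ratio₂_pos)
  have hpi : 0 < √π := by positivity
  have hpi2 : √π ^ 2 = π := Real.sq_sqrt pi_pos.le
  have hs : √(m.k₂ * m.k₃ * m.c₂ / (π * m.c₃ * m.α₃)) = m.k₂ / (√m.α₂ * √π) := by
    rw [m.k₂_eq, m.k₃_eq, Real.sqrt_eq_iff_mul_self_eq_of_pos (by positivity),
      Real.sq_sqrt m.α₃_pos.le]
    field_simp
    rw [hpi2]
  rw [h₂, q₂, hs, mul_comm m.α₂, Real.sqrt_mul pi_pos.le]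
  field_simp

theorem Q_lt_P (hz₀ : 0 < z₀) (hH : m.H z₀ = 0) {q : ℝ} (hq : m.q₂ z₀ < q) :
    m.Q z₀ < m.P q 0 := by
  have hδ : 0 < m.δ₂ * √m.α₁ := mul_pos m.δ₂_pos m.sqrt_α₁_pos
  rw [Q_zero hz₀ hH, P_eq]
  simpa using div_lt_div_of_pos_right hq hδ

theorem Q_lt_T (hz₀ : 0 < z₀) (hH : m.H z₀ = 0) {h₀ Ainf : ℝ} (hA : m.B < Ainf)
    (hh : m.h₂ z₀ Ainf < h₀) : m.Q z₀ < m.T h₀ Ainf 0 := by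
  rw [h₂_eq hz₀ hA] at hh
  have hA' := sub_pos.2 hA
  have hh0 : 0 < h₀ := (div_pos (q₂_pos hz₀) hA').trans hh
  rw [m.T_eq_P hh0 le_rfl]
  refine Q_lt_P hz₀ hH ?_
  rw [div_lt_iff₀ hA'] at hh
  simpa [fluxOfRobin, mul_comm] using hh

variable (m)

/-! ### The explicit similarity solution -/

theorem front_ratio {α α' : ℝ} (hα : 0 < α) {t : ℝ} (ht : 0 < t) (ξ : ℝ) :
    2 * ξ * √(α' * t) / (2 * √(α * t)) = ξ * √(α' / α) := by
  have h1 : √t ≠ 0 := (Real.sqrt_pos.2 ht).ne'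
  rw [Real.sqrt_mul' _ ht.le, Real.sqrt_mul' _ ht.le, Real.sqrt_div' _ hα.le]
  have : 0 < √α := Real.sqrt_pos.2 hα
  field_simp

theorem ratio_sq {α : ℝ} (hα : 0 < α) (ξ : ℝ) :
    -(ξ * √(m.α₁ / α)) ^ 2 = -ξ ^ 2 * (m.α₁ / α) := by
  rw [mul_pow, Real.sq_sqrt (div_pos m.α₁_pos hα).le]
  ring

theorem ratio_self (ξ : ℝ) : ξ * √(m.α₁ / m.α₁) = ξ := by
  rw [div_self m.α₁_pos.ne', Real.sqrt_one, mul_one]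

/-- The slope of a similarity profile at the front `2 ξ √(α₁ t)`. -/
theorem hasDerivAt_front {α t : ℝ} (hα : 0 < α) (ht : 0 < t) (a b ξ : ℝ) :
    HasDerivAt (fun x => erfProfile α a b x t)
      (b * (Real.exp (-ξ ^ 2 * (m.α₁ / α)) / (√π * √α)) / √t) (2 * ξ * √(m.α₁ * t)) := by
  have h := hasDerivAt_erfProfile α a b (2 * ξ * √(m.α₁ * t)) t
  rw [front_ratio hα ht, m.ratio_sq hα] at h
  refine h.congr_deriv ?_
  rw [Real.sqrt_mul' _ ht.le]
  simp only [div_eq_mul_inv, mul_inv]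
  ring

theorem erfProfile_front {α t : ℝ} (hα : 0 < α) (ht : 0 < t) (a b ξ : ℝ) :
    erfProfile α a b (2 * ξ * √(m.α₁ * t)) t = a + b * erf (ξ * √(m.α₁ / α)) := by
  rw [erfProfile, front_ratio hα ht]

theorem hasDerivAt_face {α t : ℝ} (ht : 0 < t) (a b : ℝ) :
    HasDerivAt (fun x => erfProfile α a b x t) (b / (√π * √α) / √t) 0 := by
  refine (hasDerivAt_erfProfile α a b 0 t).congr_deriv ?_
  rw [Real.sqrt_mul' _ ht.le]
  simp [div_eq_mul_inv]
  ring

theorem hasDerivAt_boundary {t : ℝ} (ht : 0 < t) (ξ : ℝ) :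
    HasDerivAt (fun t => 2 * ξ * √(m.α₁ * t)) (ξ * √m.α₁ / √t) t := by
  have h1 : HasDerivAt (fun s => m.α₁ * s) m.α₁ t := by
    simpa using (hasDerivAt_id t).const_mul m.α₁
  have h2 := (h1.sqrt (mul_pos m.α₁_pos ht).ne').const_mul (2 * ξ)
  refine h2.congr_deriv ?_
  have := m.sqrt_α₁_pos
  have : 0 < √t := Real.sqrt_pos.2 ht
  rw [Real.sqrt_mul' _ ht.le]
  nth_rw 1 [← Real.sq_sqrt m.α₁_pos.le]
  field_simp

/-- The jump of `erf` across the second phase. -/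
noncomputable def erfGap (ξ₁ ξ₂ : ℝ) : ℝ :=
  erf (ξ₁ * √(m.α₁ / m.α₂)) - erf (ξ₂ * √(m.α₁ / m.α₂))

/-- The similarity temperatures with free boundary parameters `ξ₁`, `ξ₂` and flux coefficient `q`
at the fixed face. -/
noncomputable def similarity (ξ₁ ξ₂ q : ℝ) : ThreePhase where
  Φ₁ := erfProfile m.α₁ (m.D + (m.C - m.D) / erfc ξ₁) (-((m.C - m.D) / erfc ξ₁))
  Φ₂ := erfProfile m.α₂
    (m.B + (m.B - m.C) / m.erfGap ξ₁ ξ₂ * erf (ξ₂ * √(m.α₁ / m.α₂)))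
    (-((m.B - m.C) / m.erfGap ξ₁ ξ₂))
  Φ₃ := erfProfile m.α₃
    (m.B + q * (√π * √m.α₃) / m.k₃ * erf (ξ₂ * √(m.α₁ / m.α₃)))
    (-(q * (√π * √m.α₃) / m.k₃))
  y₁ t := 2 * ξ₁ * √(m.α₁ * t)
  y₂ t := 2 * ξ₂ * √(m.α₁ * t)

theorem erfGap_pos {ξ₁ ξ₂ : ℝ} (h : ξ₂ < ξ₁) : 0 < m.erfGap ξ₁ ξ₂ :=
  sub_pos.2 (strictMono_erf (mul_lt_mul_of_pos_right h m.ratio₂_pos))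

/-- The Stefan condition at the first front, in dimensionless form. -/
theorem stefan₁_iff {ξ₁ ξ₂ : ℝ} (h0 : 0 < ξ₂) (h : ξ₂ < ξ₁) :
    m.k₁ * (-((m.C - m.D) / erfc ξ₁) * (Real.exp (-ξ₁ ^ 2 * (m.α₁ / m.α₁)) / (√π * √m.α₁))) -
      m.k₂ * (-((m.B - m.C) / m.erfGap ξ₁ ξ₂) *
        (Real.exp (-ξ₁ ^ 2 * (m.α₁ / m.α₂)) / (√π * √m.α₂))) = m.δ₁ * (ξ₁ * √m.α₁) ↔
    m.H ξ₁ = erf (ξ₂ * √(m.α₁ / m.α₂)) := by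
  have hg := m.erfGap_pos h
  have hφ := m.φ_pos (h0.trans h).le
  have h1 := m.sqrt_α₁_pos
  have h2 := m.sqrt_α₂_pos
  have hδ := m.δ₁_pos
  have hρ := m.ρ_pos
  have hℓ := m.ℓ₁_pos
  have hpi : 0 < √π := by positivity
  have hc := erfc_pos ξ₁
  have e1 : m.k₁ * (-((m.C - m.D) / erfc ξ₁) *
      (Real.exp (-ξ₁ ^ 2 * (m.α₁ / m.α₁)) / (√π * √m.α₁))) =
      -(m.δ₁ * √m.α₁ * (m.φ ξ₁ - ξ₁)) := by
    rw [div_self m.α₁_pos.ne', mul_one, φ_eq_add, Ste₁, δ₁, m.k₁_eq]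
    field_simp
    ring
  have e2 : m.k₂ * (-((m.B - m.C) / m.erfGap ξ₁ ξ₂) *
        (Real.exp (-ξ₁ ^ 2 * (m.α₁ / m.α₂)) / (√π * √m.α₂))) =
      -(m.δ₁ * √m.α₁ * (m.κ * Real.exp (-ξ₁ ^ 2 * (m.α₁ / m.α₂)) / m.erfGap ξ₁ ξ₂)) := by
    rw [κ]
    field_simp
  have e3 : m.H ξ₁ = erf (ξ₂ * √(m.α₁ / m.α₂)) ↔
      m.κ * Real.exp (-ξ₁ ^ 2 * (m.α₁ / m.α₂)) / m.φ ξ₁ = m.erfGap ξ₁ ξ₂ := by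
    rw [H_eq, erfGap, mul_div_assoc]
    constructor <;> intro h <;> linarith
  -- With w the numerator, the two conditions read w / gap = φ and w = gap · φ.
  rw [e1, e2, e3, div_eq_iff hφ.ne']
  set w := m.κ * Real.exp (-ξ₁ ^ 2 * (m.α₁ / m.α₂))
  have hs : 0 < m.δ₁ * √m.α₁ := mul_pos hδ h1
  constructor
  · intro he
    have : m.δ₁ * √m.α₁ * (w / m.erfGap ξ₁ ξ₂) = m.δ₁ * √m.α₁ * m.φ ξ₁ := by linarith
    have := mul_left_cancel₀ hs.ne' this
    rw [div_eq_iff hg.ne'] at this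
    linarith
  · intro he
    rw [he, mul_div_cancel_left₀ _ hg.ne']
    ring

/-- The Stefan condition at the second front, in dimensionless form. -/
theorem stefan₂_iff {ξ₁ ξ₂ : ℝ} (h0 : 0 < ξ₂) (h : ξ₂ < ξ₁)
    (hH : m.H ξ₁ = erf (ξ₂ * √(m.α₁ / m.α₂))) (q : ℝ) :
    m.k₂ * (-((m.B - m.C) / m.erfGap ξ₁ ξ₂) *
        (Real.exp (-ξ₂ ^ 2 * (m.α₁ / m.α₂)) / (√π * √m.α₂))) -
      m.k₃ * (-(q * (√π * √m.α₃) / m.k₃) *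
        (Real.exp (-ξ₂ ^ 2 * (m.α₁ / m.α₃)) / (√π * √m.α₃))) = m.δ₂ * (ξ₂ * √m.α₁) ↔
    m.Q ξ₁ = m.P q ξ₂ := by
  have hg := m.erfGap_pos h
  have hφ := m.φ_pos (h0.trans h).le
  have h1 := m.sqrt_α₁_pos
  have h2 := m.sqrt_α₂_pos
  have h3 := m.sqrt_α₃_pos
  have hk := m.k₃_pos
  have hρ := m.ρ_pos
  have hℓ₁ := m.ℓ₁_pos
  have hℓ₂ := m.ℓ₂_pos
  have hpi : 0 < √π := by positivity
  set E₁ := Real.exp (ξ₁ ^ 2 * (m.α₁ / m.α₂)) with hE₁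
  set E₂ := Real.exp (ξ₂ ^ 2 * (m.α₁ / m.α₂)) with hE₂
  have hE₁' : 0 < E₁ := Real.exp_pos _
  have hE₂' : 0 < E₂ := Real.exp_pos _
  have hn₁ : Real.exp (-ξ₁ ^ 2 * (m.α₁ / m.α₂)) = E₁⁻¹ := by rw [hE₁, ← Real.exp_neg]; ring_nf
  have hn₂ : Real.exp (-ξ₂ ^ 2 * (m.α₁ / m.α₂)) = E₂⁻¹ := by rw [hE₂, ← Real.exp_neg]; ring_nf
  have hn₃ : Real.exp (-ξ₂ ^ 2 * (m.α₁ / m.α₃ - m.α₁ / m.α₂)) =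
      Real.exp (-ξ₂ ^ 2 * (m.α₁ / m.α₃)) * E₂ := by
    rw [hE₂, ← Real.exp_add]
    ring_nf
  -- The first front condition eliminates the gap, so that ξ₁ enters the second one only through Q.
  have hgap : m.erfGap ξ₁ ξ₂ = m.κ / (E₁ * m.φ ξ₁) := by
    rw [H_eq, hn₁] at hH
    rw [erfGap, ← hH]
    field_simp
    ring
  have hBC := sub_pos.2 m.C_lt_B
  have hk₂ := m.k₂_pos
  rw [hgap, P_eq, Q, hn₂, hn₃, κ, ← hE₁, ← hE₂, δ₁, δ₂]
  set E₃ := Real.exp (-ξ₂ ^ 2 * (m.α₁ / m.α₃))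
  have e1 : m.k₂ * (-((m.B - m.C) / (m.k₂ * (m.B - m.C) /
      (√π * √m.α₂ * (m.ρ * m.ℓ₁) * √m.α₁) / (E₁ * m.φ ξ₁))) * (E₂⁻¹ / (√π * √m.α₂))) -
      m.k₃ * (-(q * (√π * √m.α₃) / m.k₃) * (E₃ / (√π * √m.α₃))) =
      (m.ρ * m.ℓ₂ * √m.α₁ / E₂) * (q / (m.ρ * m.ℓ₂ * √m.α₁) * (E₃ * E₂) -
        m.ℓ₁ / m.ℓ₂ * m.φ ξ₁ * E₁) := by
    field_simp
    ring
  have e2 : m.ρ * m.ℓ₂ * (ξ₂ * √m.α₁) = (m.ρ * m.ℓ₂ * √m.α₁ / E₂) * (ξ₂ * E₂) := by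
    field_simp
  rw [e1, e2, mul_right_inj' (by positivity)]
  constructor <;> intro h <;> linarith

/-- The temperature of the third phase satisfies the Neumann condition. -/
theorem similarity_face (ξ₁ ξ₂ q : ℝ) {t : ℝ} (ht : 0 < t) :
    ∃ g, HasDerivAt (fun x => (m.similarity ξ₁ ξ₂ q).Φ₃ x t) g 0 ∧ m.k₃ * g = -(q / √t) := by
  refine ⟨_, hasDerivAt_face ht _ _, ?_⟩
  have := m.sqrt_α₃_pos
  have := m.k₃_pos
  have : 0 < √t := Real.sqrt_pos.2 ht
  field_simp

theorem similarity_face_value (ξ₁ ξ₂ q t : ℝ) : (m.similarity ξ₁ ξ₂ q).Φ₃ 0 t =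
    m.B + q * (√π * √m.α₃) / m.k₃ * erf (ξ₂ * √(m.α₁ / m.α₃)) := by
  simp [similarity, erfProfile]

theorem similarity_neumann (ξ₁ ξ₂ q : ℝ) : m.NeumannCondition q (m.similarity ξ₁ ξ₂ q) := by
  intro t ht
  obtain ⟨g, hg, h⟩ := m.similarity_face ξ₁ ξ₂ q ht
  exact ⟨g, hg.hasDerivWithinAt, h⟩

/-- The face temperature itself depends on q, so the Robin condition is a self-consistency equation
for q. -/
theorem similarity_robin (ξ₁ ξ₂ : ℝ) {q h₀ Ainf : ℝ}
    (hq : q = h₀ * (Ainf - (m.B + q * (√π * √m.α₃) / m.k₃ * erf (ξ₂ * √(m.α₁ / m.α₃))))) :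
    m.RobinCondition h₀ Ainf (m.similarity ξ₁ ξ₂ q) := by
  intro t ht
  obtain ⟨g, hg, h⟩ := m.similarity_face ξ₁ ξ₂ q ht
  refine ⟨g, hg.hasDerivWithinAt, ?_⟩
  rw [h, similarity_face_value]
  nth_rw 1 [hq]
  ring

theorem similarity_form {ξ₁ ξ₂ : ℝ} (h1 : 0 < ξ₁) (h2 : 0 < ξ₂) (q : ℝ) :
    m.HasSimilarityForm (m.similarity ξ₁ ξ₂ q) ξ₁ ξ₂ where
  ξ₁_pos := h1
  ξ₂_pos := h2
  y₁_eq _ _ := rfl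
  y₂_eq _ _ := rfl
  Φ₃_eq := ⟨_, _, fun _ _ _ _ _ => rfl⟩
  Φ₂_eq := ⟨_, _, fun _ _ _ _ _ => rfl⟩
  Φ₁_eq := ⟨_, _, fun _ _ _ _ => rfl⟩

theorem similarity_solvesStefan {ξ₁ ξ₂ q : ℝ} (h0 : 0 < ξ₂) (h : ξ₂ < ξ₁)
    (hH : m.H ξ₁ = erf (ξ₂ * √(m.α₁ / m.α₂))) (hQ : m.Q ξ₁ = m.P q ξ₂) :
    m.SolvesStefan (m.similarity ξ₁ ξ₂ q) := by
  have hg := m.erfGap_pos h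
  have hc := erfc_pos ξ₁
  have hs : ∀ t, 0 < t → 0 < √(m.α₁ * t) := fun t ht => Real.sqrt_pos.2 (mul_pos m.α₁_pos ht)
  constructor
  · exact Continuous.continuousOn (by unfold similarity; fun_prop)
  · exact Continuous.continuousOn (by unfold similarity; fun_prop)
  · simp [similarity]
  · simp [similarity]
  · intro t ht
    have := hs t ht
    simp only [similarity]
    positivity
  · intro t ht
    exact mul_lt_mul_of_pos_right (by linarith) (hs t ht)
  · exact (continuousOn_erfProfile m.α₃_pos _ _).mono fun p hp => hp.1
  · exact (continuousOn_erfProfile m.α₂_pos _ _).mono fun p hp => hp.1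
  · exact (continuousOn_erfProfile m.α₁_pos _ _).mono fun p hp => hp.1
  · exact fun x t ht _ _ => heatEqAt_erfProfile m.α₃_pos ht _ _ x
  · exact fun x t ht _ _ => heatEqAt_erfProfile m.α₂_pos ht _ _ x
  · exact fun x t ht _ => heatEqAt_erfProfile m.α₁_pos ht _ _ x
  · intro t ht
    simp only [similarity, m.erfProfile_front m.α₃_pos ht]
    ring
  · intro t ht
    simp only [similarity, m.erfProfile_front m.α₂_pos ht]
    ring
  · intro t ht
    simp only [similarity, m.erfProfile_front m.α₂_pos ht]
    have : (m.B - m.C) / m.erfGap ξ₁ ξ₂ * m.erfGap ξ₁ ξ₂ = m.B - m.C := div_mul_cancel₀ _ hg.ne'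
    rw [erfGap] at *
    linarith
  · intro t ht
    simp only [similarity, m.erfProfile_front m.α₁_pos ht, ratio_self]
    have : (m.C - m.D) / erfc ξ₁ * erfc ξ₁ = m.C - m.D := div_mul_cancel₀ _ hc.ne'
    rw [erfc] at *
    linarith
  · intro x hx
    simpa [similarity] using tendsto_erfProfile_zero m.α₁_pos hx
      (m.D + (m.C - m.D) / erfc ξ₁) (-((m.C - m.D) / erfc ξ₁))
  · intro t ht
    simpa [similarity] using tendsto_erfProfile_atTop m.α₁_pos ht
      (m.D + (m.C - m.D) / erfc ξ₁) (-((m.C - m.D) / erfc ξ₁))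
  · intro t ht
    refine ⟨_, _, _, (m.hasDerivAt_front m.α₂_pos ht _ _ ξ₂).hasDerivWithinAt,
      (m.hasDerivAt_front m.α₃_pos ht _ _ ξ₂).hasDerivWithinAt, m.hasDerivAt_boundary ht ξ₂, ?_⟩
    have := (m.stefan₂_iff h0 h hH q).2 hQ
    -- Slopes and front speeds all scale like 1/√t, so the condition is independent of time.
    linear_combination (1 / √t) * this
  · intro t ht
    refine ⟨_, _, _, (m.hasDerivAt_front m.α₁_pos ht _ _ ξ₁).hasDerivWithinAt,
      (m.hasDerivAt_front m.α₂_pos ht _ _ ξ₁).hasDerivWithinAt, m.hasDerivAt_boundary ht ξ₁, ?_⟩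
    have := (m.stefan₁_iff h0 h).2 hH
    linear_combination (1 / √t) * this

/-! ### Every similarity solution is explicit -/

/-- Lets one-sided slopes of an arbitrary solution be replaced by those of its profile. -/
theorem eq_of_hasDerivWithinAt {f g : ℝ → ℝ} {f' g' x : ℝ} {s : Set ℝ}
    (hf : HasDerivWithinAt f f' s x) (hg : HasDerivAt g g' x) (h : EqOn f g s) (hx : x ∈ s)
    (hs : UniqueDiffWithinAt ℝ s x) : f' = g' :=
  hs.eq_deriv _ (hf.congr (fun _ hy => (h hy).symm) (h hx).symm) hg.hasDerivWithinAt

variable {m}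

/-- By self-similarity the conditions at t = 1 suffice. Two values determine phase 2, a value and
the limit at infinity phase 1, and one value leaves a single free parameter in phase 3. -/
theorem exists_similarity {S : ThreePhase} {ξ₁ ξ₂ : ℝ} (hS : m.SolvesStefan S)
    (hF : m.HasSimilarityForm S ξ₁ ξ₂) :
    ξ₂ < ξ₁ ∧ m.H ξ₁ = erf (ξ₂ * √(m.α₁ / m.α₂)) ∧
      ∃ q, m.Q ξ₁ = m.P q ξ₂ ∧ S.Coincides (m.similarity ξ₁ ξ₂ q) := by
  obtain ⟨a₁, b₁, h₁⟩ := hF.Φ₁_eq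
  obtain ⟨a₂, b₂, h₂⟩ := hF.Φ₂_eq
  obtain ⟨a₃, b₃, h₃⟩ := hF.Φ₃_eq
  have h0 := hF.ξ₂_pos
  have hs : 0 < √(m.α₁ * 1) := Real.sqrt_pos.2 (mul_pos m.α₁_pos one_pos)
  have hy₁ := hF.y₁_eq 1 zero_le_one
  have hy₂ := hF.y₂_eq 1 zero_le_one
  have hlt := hS.y₂_lt_y₁ 1 one_pos
  have hpos := hS.y₂_pos 1 one_pos
  have h : ξ₂ < ξ₁ := by
    rw [hy₁, hy₂] at hlt
    linarith [lt_of_mul_lt_mul_right hlt hs.le]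
  have hg := m.erfGap_pos h
  have hc := erfc_pos ξ₁
  have hk := m.k₃_pos
  have hA₃ := m.sqrt_α₃_pos
  have hpi : 0 < √π := by positivity
  have e₃ : a₃ + b₃ * erf (ξ₂ * √(m.α₁ / m.α₃)) = m.B := by
    rw [← hS.Φ₃_eq_B 1 one_pos, h₃ _ _ one_pos hpos.le le_rfl, hy₂, front_ratio m.α₃_pos one_pos]
  have e₂ : a₂ + b₂ * erf (ξ₂ * √(m.α₁ / m.α₂)) = m.B := by
    rw [← hS.Φ₂_eq_B 1 one_pos, h₂ _ _ one_pos le_rfl hlt.le, hy₂, front_ratio m.α₂_pos one_pos]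
  have e₂' : a₂ + b₂ * erf (ξ₁ * √(m.α₁ / m.α₂)) = m.C := by
    rw [← hS.Φ₂_eq_C 1 one_pos, h₂ _ _ one_pos hlt.le le_rfl, hy₁, front_ratio m.α₂_pos one_pos]
  have e₁ : a₁ + b₁ * erf ξ₁ = m.C := by
    rw [← hS.Φ₁_eq_C 1 one_pos, h₁ _ _ one_pos le_rfl, hy₁, front_ratio m.α₁_pos one_pos,
      ratio_self]
  have e₁' : a₁ + b₁ = m.D := by
    refine tendsto_nhds_unique (tendsto_erfProfile_atTop m.α₁_pos one_pos a₁ b₁)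
      ((hS.atInfinity 1 one_pos).congr' ?_)
    filter_upwards [eventually_ge_atTop (S.y₁ 1)] with x hx using h₁ x 1 one_pos hx
  have hb₁ : b₁ = -((m.C - m.D) / erfc ξ₁) := by
    rw [← neg_div, eq_div_iff hc.ne', erfc]
    linarith
  have hb₂ : b₂ = -((m.B - m.C) / m.erfGap ξ₁ ξ₂) := by
    rw [← neg_div, eq_div_iff hg.ne', erfGap]
    linarith
  -- q is the flux coefficient at the face: the slope of Φ₃ at x = 0 is b₃ / (√π √α₃ √t).
  obtain ⟨q, hb₃⟩ : ∃ q, b₃ = -(q * (√π * √m.α₃) / m.k₃) :=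
    ⟨-(b₃ * m.k₃ / (√π * √m.α₃)), by field_simp⟩
  have ha₁ : a₁ = m.D + (m.C - m.D) / erfc ξ₁ := by linarith
  have ha₂ : a₂ = m.B + (m.B - m.C) / m.erfGap ξ₁ ξ₂ * erf (ξ₂ * √(m.α₁ / m.α₂)) := by
    rw [hb₂] at e₂
    linarith
  have ha₃ : a₃ = m.B + q * (√π * √m.α₃) / m.k₃ * erf (ξ₂ * √(m.α₁ / m.α₃)) := by
    rw [hb₃] at e₃
    linarith
  have hv₁ : ∀ v, HasDerivAt S.y₁ v 1 → v = ξ₁ * √m.α₁ / √1 := fun v hv =>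
    hv.unique ((m.hasDerivAt_boundary one_pos ξ₁).congr_of_eventuallyEq
      ((eventually_ge_nhds one_pos).mono fun t ht => hF.y₁_eq t ht))
  have hv₂ : ∀ v, HasDerivAt S.y₂ v 1 → v = ξ₂ * √m.α₁ / √1 := fun v hv =>
    hv.unique ((m.hasDerivAt_boundary one_pos ξ₂).congr_of_eventuallyEq
      ((eventually_ge_nhds one_pos).mono fun t ht => hF.y₂_eq t ht))
  have hH : m.H ξ₁ = erf (ξ₂ * √(m.α₁ / m.α₂)) := by
    obtain ⟨g₁, g₂, v, hg₁, hg₂, hv, heq⟩ := hS.stefan₁ 1 one_pos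
    have r₁ := eq_of_hasDerivWithinAt hg₁ (g := fun x => erfProfile m.α₁ a₁ b₁ x 1)
      (by rw [hy₁]; exact m.hasDerivAt_front m.α₁_pos one_pos a₁ b₁ ξ₁)
      (fun x hx => h₁ x 1 one_pos hx) self_mem_Ici (uniqueDiffOn_Ici _ _ self_mem_Ici)
    have r₂ := eq_of_hasDerivWithinAt hg₂ (g := fun x => erfProfile m.α₂ a₂ b₂ x 1)
      (by rw [hy₁]; exact m.hasDerivAt_front m.α₂_pos one_pos a₂ b₂ ξ₁)
      (fun x hx => h₂ x 1 one_pos hx.1 hx.2) (right_mem_Icc.2 hlt.le)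
      (uniqueDiffOn_Icc hlt _ (right_mem_Icc.2 hlt.le))
    rw [r₁, r₂, hv₁ v hv, Real.sqrt_one, div_one, div_one, div_one, hb₁, hb₂] at heq
    exact (m.stefan₁_iff h0 h).1 heq
  refine ⟨h, hH, q, ?_, ?_⟩
  · obtain ⟨g₂, g₃, v, hg₂, hg₃, hv, heq⟩ := hS.stefan₂ 1 one_pos
    have r₂ := eq_of_hasDerivWithinAt hg₂ (g := fun x => erfProfile m.α₂ a₂ b₂ x 1)
      (by rw [hy₂]; exact m.hasDerivAt_front m.α₂_pos one_pos a₂ b₂ ξ₂)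
      (fun x hx => h₂ x 1 one_pos hx.1 hx.2) (left_mem_Icc.2 hlt.le)
      (uniqueDiffOn_Icc hlt _ (left_mem_Icc.2 hlt.le))
    have r₃ := eq_of_hasDerivWithinAt hg₃ (g := fun x => erfProfile m.α₃ a₃ b₃ x 1)
      (by rw [hy₂]; exact m.hasDerivAt_front m.α₃_pos one_pos a₃ b₃ ξ₂)
      (fun x hx => h₃ x 1 one_pos hx.1 hx.2) (right_mem_Icc.2 hpos.le)
      (uniqueDiffOn_Icc hpos _ (right_mem_Icc.2 hpos.le))
    rw [r₂, r₃, hv₂ v hv, Real.sqrt_one, div_one, div_one, div_one, hb₂, hb₃] at heq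
    exact (m.stefan₂_iff h0 h hH q).1 heq
  · subst ha₁ ha₂ ha₃ hb₁ hb₂ hb₃
    exact ⟨hF.y₁_eq, hF.y₂_eq, h₃, h₂, h₁⟩

/-! ### Existence and uniqueness for the two face conditions -/

/-- The flux of a solution at the fixed face determines its flux coefficient. -/
theorem face_flux {S : ThreePhase} {ξ₁ ξ₂ q g : ℝ} (hS : m.SolvesStefan S)
    (hC : S.Coincides (m.similarity ξ₁ ξ₂ q))
    (hg : HasDerivWithinAt (fun x => S.Φ₃ x 1) g (Icc 0 (S.y₂ 1)) 0) : m.k₃ * g = -q := by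
  obtain ⟨g', hg', h⟩ := m.similarity_face ξ₁ ξ₂ q one_pos
  have hpos := hS.y₂_pos 1 one_pos
  rw [eq_of_hasDerivWithinAt hg hg' (fun x hx => hC.Φ₃_eq x 1 one_pos hx.1 hx.2)
    (left_mem_Icc.2 hpos.le) (uniqueDiffOn_Icc hpos _ (left_mem_Icc.2 hpos.le)), h,
    Real.sqrt_one, div_one]

theorem flux_of_neumann {S : ThreePhase} {ξ₁ ξ₂ q q₀ : ℝ} (hS : m.SolvesStefan S)
    (hC : S.Coincides (m.similarity ξ₁ ξ₂ q)) (hN : m.NeumannCondition q₀ S) : q = q₀ := by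
  obtain ⟨g, hg, h⟩ := hN 1 one_pos
  rw [face_flux hS hC hg, Real.sqrt_one, div_one] at h
  linarith

/-- The face temperature is affine in q, so the Robin condition is a linear equation for q; h₀ > 0
makes its leading coefficient positive. -/
theorem flux_of_robin {S : ThreePhase} {ξ₁ ξ₂ q h₀ Ainf : ℝ} (hS : m.SolvesStefan S)
    (hh : 0 < h₀) (hξ : 0 < ξ₂) (hC : S.Coincides (m.similarity ξ₁ ξ₂ q))
    (hR : m.RobinCondition h₀ Ainf S) : q = m.fluxOfRobin h₀ Ainf ξ₂ := by
  obtain ⟨g, hg, h⟩ := hR 1 one_pos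
  have hd := m.fluxOfRobin_den_pos hh hξ.le
  rw [face_flux hS hC hg, Real.sqrt_one, div_one,
    hC.Φ₃_eq 0 1 one_pos le_rfl (hS.y₂_pos 1 one_pos).le, similarity_face_value] at h
  rw [fluxOfRobin, eq_div_iff hd.ne', sqrt_pi_mul_α₃]
  linear_combination -h

/-- Uniqueness of the root on (z₀, ∞) therefore covers every similarity solution. -/
theorem parameter_gt {z₀ ξ₁ ξ₂ : ℝ} (hz₀ : 0 < z₀) (hz : m.H z₀ = 0) (h1 : 0 < ξ₁) (h2 : 0 < ξ₂)
    (hH : m.H ξ₁ = erf (ξ₂ * √(m.α₁ / m.α₂))) : z₀ < ξ₁ := by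
  refine (m.strictMonoOn_H.lt_iff_lt hz₀.le h1.le).1 ?_
  rw [hz, hH]
  exact erf_pos (mul_pos h2 m.ratio₂_pos)

theorem neumann_unique {z₀ q₀ ξ₁ ξ₂ : ℝ} (hz₀ : 0 < z₀) (hz : m.H z₀ = 0)
    (hp : m.NeumannParameters z₀ q₀ ξ₁ ξ₂) {S : ThreePhase} (hS : m.SolvesNeumann q₀ S) :
    S.Coincides (m.similarity ξ₁ ξ₂ q₀) := by
  obtain ⟨hS, hN, η₁, η₂, hF⟩ := hS
  obtain ⟨-, hH, q, hQ, hC⟩ := exists_similarity hS hF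
  obtain rfl := flux_of_neumann hS hC hN
  obtain rfl := eq_second hH
  obtain rfl := (hp.1 η₁ (parameter_gt hz₀ hz hF.ξ₁_pos hF.ξ₂_pos hH)).1 hQ
  rwa [hp.2.2]

theorem robin_unique {z₀ h₀ Ainf ξ₁ ξ₂ : ℝ} (hz₀ : 0 < z₀) (hz : m.H z₀ = 0) (hh : 0 < h₀)
    (hp : m.RobinParameters z₀ h₀ Ainf ξ₁ ξ₂) {S : ThreePhase} (hS : m.SolvesRobin h₀ Ainf S) :
    S.Coincides (m.similarity ξ₁ ξ₂ (m.fluxOfRobin h₀ Ainf ξ₂)) := by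
  obtain ⟨hS, hR, η₁, η₂, hF⟩ := hS
  obtain ⟨-, hH, q, hQ, hC⟩ := exists_similarity hS hF
  obtain rfl := flux_of_robin hS hh hF.ξ₂_pos hC hR
  obtain rfl := eq_second hH
  rw [← m.T_eq_P hh hF.ξ₂_pos.le] at hQ
  obtain rfl := (hp.1 η₁ (parameter_gt hz₀ hz hF.ξ₁_pos hF.ξ₂_pos hH)).1 hQ
  rwa [hp.2.2]

theorem exists_neumannParameters {z₀ q₀ : ℝ} (hz₀ : 0 < z₀) (hz : m.H z₀ = 0)
    (hq : m.q₂ z₀ < q₀) : ∃ ξ₁ ξ₂, m.NeumannParameters z₀ q₀ ξ₁ ξ₂ := by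
  obtain ⟨ξ, h, hu⟩ := exists_root hz₀ hz (m.strictAntiOn_P ((q₂_pos hz₀).trans hq).le)
    (m.continuous_P q₀).continuousOn (Q_lt_P hz₀ hz hq)
  exact ⟨ξ, _, hu, h, rfl⟩

theorem exists_robinParameters {z₀ h₀ Ainf : ℝ} (hz₀ : 0 < z₀) (hz : m.H z₀ = 0)
    (hA : m.B < Ainf) (hh0 : 0 < h₀) (hh : m.h₂ z₀ Ainf < h₀) :
    ∃ ξ₁ ξ₂, m.RobinParameters z₀ h₀ Ainf ξ₁ ξ₂ := by
  obtain ⟨ξ, h, hu⟩ := exists_root hz₀ hz (m.strictAntiOn_T hh0 hA)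
    (m.continuousOn_T hh0) (Q_lt_T hz₀ hz hA hh)
  exact ⟨ξ, _, hu, h, rfl⟩

theorem similarity_solvesNeumann {z₀ q ξ : ℝ} (hz₀ : 0 < z₀) (hz : m.H z₀ = 0) (hξ : z₀ < ξ)
    (hQ : m.Q ξ = m.P q (m.second ξ)) :
    m.SolvesNeumann q (m.similarity ξ (m.second ξ) q) :=
  ⟨m.similarity_solvesStefan (second_pos hz₀ hz hξ) (second_lt hz₀ hz hξ.le)
    (erf_second hz₀ hz hξ.le).symm hQ, m.similarity_neumann _ _ _, _, _,
    m.similarity_form (hz₀.trans hξ) (second_pos hz₀ hz hξ) q⟩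

theorem isTheNeumannSolution_similarity {z₀ q₀ ξ₁ ξ₂ : ℝ} (hz₀ : 0 < z₀) (hz : m.H z₀ = 0)
    (hp : m.NeumannParameters z₀ q₀ ξ₁ ξ₂) :
    m.IsTheNeumannSolution q₀ (m.similarity ξ₁ ξ₂ q₀) := by
  refine ⟨?_, fun S hS => neumann_unique hz₀ hz hp hS⟩
  obtain ⟨hu, hξ, rfl⟩ := hp
  exact similarity_solvesNeumann hz₀ hz hξ ((hu _ hξ).2 rfl)

theorem isTheRobinSolution_similarity {z₀ h₀ Ainf ξ₁ ξ₂ : ℝ} (hz₀ : 0 < z₀) (hz : m.H z₀ = 0)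
    (hh : 0 < h₀) (hp : m.RobinParameters z₀ h₀ Ainf ξ₁ ξ₂) :
    m.IsTheRobinSolution h₀ Ainf (m.similarity ξ₁ ξ₂ (m.fluxOfRobin h₀ Ainf ξ₂)) := by
  refine ⟨?_, fun S hS => robin_unique hz₀ hz hh hp hS⟩
  obtain ⟨hu, hξ, rfl⟩ := hp
  have h2 := (second_pos hz₀ hz hξ).le
  have hQ : m.Q ξ₁ = m.T h₀ Ainf (m.second ξ₁) := (hu _ hξ).2 rfl
  rw [m.T_eq_P hh h2] at hQ
  obtain ⟨hS, -, hF⟩ := similarity_solvesNeumann hz₀ hz hξ hQ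
  refine ⟨hS, m.similarity_robin _ _ ?_, hF⟩
  have hd := m.fluxOfRobin_den_pos hh h2
  -- Clearing the denominator of the flux gives the self-consistency equation.
  have hq : m.fluxOfRobin h₀ Ainf (m.second ξ₁) * _ = _ := div_mul_cancel₀ _ hd.ne'
  rw [sqrt_pi_mul_α₃] at hq
  linear_combination hq

/-- `fluxOfRobin` inverts `robinOfFlux`. -/
theorem fluxOfRobin_robinOfFlux {q Ainf ξ : ℝ} (hq : 0 < q) (hξ : 0 ≤ ξ)
    (hh : 0 < m.robinOfFlux q Ainf ξ) : m.fluxOfRobin (m.robinOfFlux q Ainf ξ) Ainf ξ = q := by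
  have hd := m.fluxOfRobin_den_pos hh hξ
  rw [fluxOfRobin, div_eq_iff hd.ne']
  -- A positive quotient with positive numerator q has a positive denominator.
  have hden : 0 < (Ainf - m.B) - q * (√(π * m.α₃) / m.k₃) * erf (ξ * √(m.α₁ / m.α₃)) :=
    (div_pos_iff_of_pos_left hq).1 hh
  have h : m.robinOfFlux q Ainf ξ * _ = q := div_mul_cancel₀ _ hden.ne'
  linear_combination h

end StefanData

theorem theorem3p3 (m : StefanData) :
    ∃ z₀ : ℝ, 0 < z₀ ∧ (∀ z, 0 ≤ z → (m.H z = 0 ↔ z = z₀)) ∧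
      -- (a) from the Robin problem to the Neumann problem
      (∀ h₀ Ainf : ℝ, m.B < Ainf → m.h₂ z₀ Ainf < h₀ →
        ∃ (S : ThreePhase) (ξ₁ ξ₂ : ℝ),
          m.IsTheRobinSolution h₀ Ainf S ∧
          m.HasSimilarityForm S ξ₁ ξ₂ ∧ m.RobinParameters z₀ h₀ Ainf ξ₁ ξ₂ ∧
          (m.q₂ z₀ < m.fluxOfRobin h₀ Ainf ξ₂ →
            m.IsTheNeumannSolution (m.fluxOfRobin h₀ Ainf ξ₂) S)) ∧
      -- (b) from the Neumann problem to the Robin problem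
      (∀ q₀ : ℝ, m.q₂ z₀ < q₀ →
        ∃ (S : ThreePhase) (l₁ l₂ : ℝ),
          m.IsTheNeumannSolution q₀ S ∧
          m.HasSimilarityForm S l₁ l₂ ∧ m.NeumannParameters z₀ q₀ l₁ l₂ ∧
          ∀ Ainf : ℝ, m.B < Ainf → m.h₂ z₀ Ainf < m.robinOfFlux q₀ Ainf l₂ →
            m.IsTheRobinSolution (m.robinOfFlux q₀ Ainf l₂) Ainf S) := by
  obtain ⟨z₀, hz₀, hz⟩ := m.exists_zero_H
  have hh₂ : ∀ Ainf, m.B < Ainf → 0 < m.h₂ z₀ Ainf := fun Ainf hA => by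
    rw [StefanData.h₂_eq hz₀ hA]
    exact div_pos (StefanData.q₂_pos hz₀) (sub_pos.2 hA)
  refine ⟨z₀, hz₀, fun z hz' => ⟨fun h => ?_, ?_⟩, fun h₀ Ainf hA hh => ?_, fun q₀ hq => ?_⟩
  · exact m.strictMonoOn_H.injOn hz' hz₀.le (h.trans hz.symm)
  · rintro rfl
    exact hz
  · have hh0 := (hh₂ Ainf hA).trans hh
    obtain ⟨ξ₁, ξ₂, hp⟩ := StefanData.exists_robinParameters hz₀ hz hA hh0 hh
    have h2 : 0 < ξ₂ := by rw [hp.2.2]; exact StefanData.second_pos hz₀ hz hp.2.1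
    refine ⟨_, ξ₁, ξ₂, StefanData.isTheRobinSolution_similarity hz₀ hz hh0 hp,
      m.similarity_form (hz₀.trans hp.2.1) h2 _, hp, fun hq => ?_⟩
    obtain ⟨η₁, η₂, hp'⟩ := StefanData.exists_neumannParameters hz₀ hz hq
    -- The Robin root satisfies the Neumann equation whose flux is evaluated at ξ₂, so it is the
    -- Neumann root.
    have hQ : m.Q ξ₁ = m.T h₀ Ainf (m.second ξ₁) := (hp.1 _ hp.2.1).2 rfl
    rw [← hp.2.2, m.T_eq_P hh0 h2.le] at hQ
    have h1 : ξ₁ = η₁ := (hp'.1 _ hp.2.1).1 (by rw [← hp.2.2]; exact hQ)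
    have h2' : ξ₂ = η₂ := by rw [hp.2.2, hp'.2.2, h1]
    subst h1 h2'
    exact StefanData.isTheNeumannSolution_similarity hz₀ hz hp'
  · have hq0 := (StefanData.q₂_pos hz₀).trans hq
    obtain ⟨l₁, l₂, hp⟩ := StefanData.exists_neumannParameters hz₀ hz hq
    have h2 : 0 < l₂ := by rw [hp.2.2]; exact StefanData.second_pos hz₀ hz hp.2.1
    refine ⟨_, l₁, l₂, StefanData.isTheNeumannSolution_similarity hz₀ hz hp,
      m.similarity_form (hz₀.trans hp.2.1) h2 _, hp, fun Ainf hA hh => ?_⟩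
    have hh0 := (hh₂ Ainf hA).trans hh
    have hflux := StefanData.fluxOfRobin_robinOfFlux hq0 h2.le hh0
    obtain ⟨ξ₁, ξ₂, hp'⟩ := StefanData.exists_robinParameters hz₀ hz hA hh0 hh
    have hQ : m.Q l₁ = m.P q₀ (m.second l₁) := (hp.1 _ hp.2.1).2 rfl
    -- At l₂ the new Robin data return the flux q₀, so T and P agree there and l₁ solves the Robin
    -- equation.
    have h1 : l₁ = ξ₁ := by
      refine (hp'.1 _ hp.2.1).1 ?_
      rw [StefanData.U, ← hp.2.2, m.T_eq_P hh0 h2.le, hflux, hQ, hp.2.2]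
    have h2' : l₂ = ξ₂ := by rw [hp.2.2, hp'.2.2, h1]
    subst h1 h2'
    have := StefanData.isTheRobinSolution_similarity hz₀ hz hh0 hp'
    rwa [hflux] at this
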